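/- Consider a discrete-time LTI system with $m$ inputs and $p$ outputs, with transfer function matrix $G(z)$, given by a real state-space representation $x(t+1)=Ax(t)+Bu(t)$, $y(t)=Cx(t)+Du(t)$ of state dimension $n'$ that has, for every $k$, the same set $\mathcal W_k$ of length-$k$ input-output trajectories as some minimal realization of $G$. Let $n$ be the minimal order of $G$ (the state dimension of a minimal realization), $l$ its lag (the observability index of that minimal realization), and $n_i$ the minimal order of the $i$-th row $G_i$ of $G$. Let $N\ge l$ and $N\ge n_i$ for $i=1,\dots,p$. Let $(u^j,y^j)\in\mathcal W_{N+1}$, $j=1,\dots,T$, be given trajectories, with time indices $0,\dots,N$. Let $U_{\mathrm p}\in\mathbb R^{mN\times T}$ and $Y_{\mathrm p}\in\mathbb R^{pN\times T}$ have as $j$-th columns the stacked first $N$ samples of $u^j$ and of $y^j$, and let $U_{\mathrm f}\in\mathbb R^{m\times T}$ and $Y_{\mathrm f}\in\mathbb R^{p\times T}$ have as $j$-th columns the last samples $u^j(N)$ and $y^j(N)$. Assume the rank condition $$\operatorname{rank}\begin{bmatrix}U_{\mathrm p}\\U_{\mathrm f}\\Y_{\mathrm p}\end{bmatrix}=m(N+1)+n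 .$$ For each $i$ let $Y_{\mathrm p,i}$ consist of the $N$ rows of $Y_{\mathrm p}$ that belong to the $i$-th output, let $Y_{\mathrm f,i}$ be the $i$-th row of $Y_{\mathrm f}$, and let $H_i=\begin{bmatrix}U_{\mathrm p}\\U_{\mathrm f}\\Y_{\mathrm p,i}\end{bmatrix}$, with Moore–Penrose inverse $H_i^\dagger$. Let $(u(t),y(t))_{t\ge -N}$ be any input-output trajectory of the system. For an initial guess $\hat y(-N),\dots,\hat y(-1)\in\mathbb R^p$ define the predicted output recursively by $$\hat y_i(t)=Y_{\mathrm f,i}H_i^\dagger\begin{bmatrix}u(t-N:t-1)\\u(t)\\\hat y_i(t-N:t-1)\end{bmatrix},\qquad i=1,\dots,p,\quad t\ge 0,$$ where $v(a:b)$ denotes the stacked vector of $v(a),\dots,v(b)$. Then $\lVert y(t)-\hat y(t)\rVert\to0$ as $t\to\infty$ for every initial guess $\hat y(-N),\dots,\hat y(-1)$ if and only if the system is stable, that is, all poles of $G(z)$ lie in the open unit disk $\{|z|<1\}$. -/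

import Mathlib

open Filter Topology

noncomputable section

/-- A discrete-time linear time-invariant state-space model
`x(t+1) = A x(t) + B u(t)`, `y(t) = C x(t) + D u(t)` with `m` inputs, `p` outputs and
`n` states. -/
structure StateSpace (m p n : ℕ) where
  /-- state matrix -/
  A : Matrix (Fin n) (Fin n) ℝ
  /-- input matrix -/
  B : Matrix (Fin n) (Fin m) ℝ
  /-- output matrix -/
  C : Matrix (Fin p) (Fin n) ℝ
  /-- feedthrough matrix -/
  D : Matrix (Fin p) (Fin m) ℝ

namespace StateSpace

variable {m p n : ℕ}

/-- The transfer function matrix `G(z) = C (zI - A)⁻¹ B + D`. -/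
def transferMatrix (S : StateSpace m p n) : Matrix (Fin p) (Fin m) (RatFunc ℝ) :=
  S.C.map RatFunc.C *
      (Matrix.scalar (Fin n) (RatFunc.X : RatFunc ℝ) - S.A.map RatFunc.C)⁻¹ *
      S.B.map RatFunc.C +
    S.D.map RatFunc.C

/-- The set of all length-`k` input-output trajectories. -/
def trajectories (S : StateSpace m p n) (k : ℕ) :
    Set ((Fin k → Fin m → ℝ) × (Fin k → Fin p → ℝ)) :=
  {w | ∃ x : Fin (k + 1) → Fin n → ℝ, ∀ t : Fin k,
    x t.succ = S.A.mulVec (x t.castSucc) + S.B.mulVec (w.1 t) ∧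
    w.2 t = S.C.mulVec (x t.castSucc) + S.D.mulVec (w.1 t)}

/-- `(u, y)` is an input-output trajectory on the infinite time axis `0, 1, 2, …`. -/
def IsTrajectory (S : StateSpace m p n) (u : ℕ → Fin m → ℝ) (y : ℕ → Fin p → ℝ) : Prop :=
  ∃ x : ℕ → Fin n → ℝ, ∀ t : ℕ,
    x (t + 1) = S.A.mulVec (x t) + S.B.mulVec (u t) ∧
    y t = S.C.mulVec (x t) + S.D.mulVec (u t)

/-- The observability matrix with block rows `C, C A, …, C A^(k-1)`. -/
def observabilityMatrix (S : StateSpace m p n) (k : ℕ) :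
    Matrix (Fin k × Fin p) (Fin n) ℝ :=
  Matrix.of fun r s => (S.C * S.A ^ (r.1 : ℕ)) r.2 s

/-- The observability index: the least `k` such that the observability matrix with `k` block
rows has full column rank. (Used for minimal, hence observable, realizations only.) -/
def observabilityIndex (S : StateSpace m p n) : ℕ :=
  sInf {k | (S.observabilityMatrix k).rank = n}

end StateSpace

/-- The minimal order of a proper transfer function matrix: the least state dimension of a
state-space realization. -/
def minimalOrder {m p : ℕ} (G : Matrix (Fin p) (Fin m) (RatFunc ℝ)) : ℕ :=
  sInf {k | ∃ R : StateSpace m p k, R.transferMatrix = G}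

/-- The `i`-th row of a transfer function matrix, as a `1 × m` transfer function matrix. -/
def outputRow {m p : ℕ} (G : Matrix (Fin p) (Fin m) (RatFunc ℝ)) (i : Fin p) :
    Matrix (Fin 1) (Fin m) (RatFunc ℝ) :=
  G.submatrix (fun _ => i) id

/-- Stability: all poles of all entries of the transfer function matrix (over `ℂ`) lie in the
open unit disk. -/
def IsStableTransfer {m p : ℕ} (G : Matrix (Fin p) (Fin m) (RatFunc ℝ)) : Prop :=
  ∀ i j, ∀ z : ℂ, Polynomial.aeval z (G i j).denom = 0 → ‖z‖ < 1

namespace StateSpace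

variable {m p n : ℕ}

/-- A realization is minimal if its state dimension is the minimal order of its transfer
function matrix. -/
def IsMinimal (S : StateSpace m p n) : Prop :=
  minimalOrder S.transferMatrix = n

end StateSpace

section MoorePenrose

variable {ι κ : Type*} [Fintype ι] [Fintype κ]

/-- The four Penrose conditions for a real matrix. -/
def IsMoorePenrose (A : Matrix ι κ ℝ) (X : Matrix κ ι ℝ) : Prop :=
  A * X * A = A ∧ X * A * X = X ∧ (A * X).transpose = A * X ∧ (X * A).transpose = X * A

theorem exists_isMoorePenrose (A : Matrix ι κ ℝ) : ∃ X, IsMoorePenrose A X := by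
  classical
  have hS : (A.transpose * A).IsHermitian := by
    simpa using Matrix.isHermitian_conjTranspose_mul_self A
  set U : Matrix κ κ ℝ := (hS.eigenvectorUnitary : Matrix κ κ ℝ) with hU
  set d : κ → ℝ := hS.eigenvalues with hd
  have hUU : U.transpose * U = 1 := by
    have := Unitary.coe_star_mul_self hS.eigenvectorUnitary
    simpa [Matrix.star_eq_conjTranspose] using this
  have hspec : A.transpose * A = U * Matrix.diagonal d * U.transpose := by
    have := hS.spectral_theorem
    simpa [Unitary.conjStarAlgAut_apply, Matrix.star_eq_conjTranspose, hU, hd,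
      Function.comp_def] using this
  set P : Matrix κ κ ℝ := U * Matrix.diagonal (fun k => (d k)⁻¹) * U.transpose with hP
  set S := A.transpose * A with hSdef
  have key : ∀ a b : κ → ℝ, (U * Matrix.diagonal a * U.transpose) *
      (U * Matrix.diagonal b * U.transpose) =
      U * Matrix.diagonal (fun k => a k * b k) * U.transpose := by
    intro a b
    calc _ = U * Matrix.diagonal a * (U.transpose * U) * Matrix.diagonal b * U.transpose := by
          simp only [Matrix.mul_assoc]
      _ = _ := by
          rw [hUU, Matrix.mul_one, Matrix.mul_assoc U, Matrix.diagonal_mul_diagonal]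
  have hPt : P.transpose = P := by
    simp [hP, Matrix.transpose_mul, Matrix.mul_assoc]
  have hSt : S.transpose = S := by simp [hSdef, Matrix.transpose_mul]
  have hPS : P * S = S * P := by
    rw [hspec, hP, key, key]; simp only [mul_comm]
  have hSPS : S * P * S = S := by
    rw [hspec, hP, key, key]; congr 3; funext k
    by_cases h : d k = 0 <;> simp [h]
  have hPSP : P * S * P = P := by
    rw [hspec, hP, key, key]; congr 3; funext k
    by_cases h : d k = 0 <;> simp [h]
  have hA : A * P * S = A := by
    have h0 : (A * P * S - A).conjTranspose * (A * P * S - A) = 0 := by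
      rw [Matrix.conjTranspose_eq_transpose_of_trivial]
      have e : (A * P * S - A).transpose = S * P * A.transpose - A.transpose := by
        simp [Matrix.transpose_mul, hPt, hSt, Matrix.mul_assoc]
      rw [e]
      calc _ = S * P * S * P * S - S * P * S - (S * P * S - S) := by
            simp only [hSdef, Matrix.sub_mul, Matrix.mul_sub, Matrix.mul_assoc]
        _ = 0 := by rw [hSPS, hSPS]; simp
    exact sub_eq_zero.mp (Matrix.conjTranspose_mul_self_eq_zero.mp h0)
  refine ⟨P * A.transpose, ?_, ?_, ?_, ?_⟩
  · calc _ = A * P * S := by simp only [hSdef, Matrix.mul_assoc]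
      _ = A := hA
  · calc _ = P * S * P * A.transpose := by simp only [hSdef, Matrix.mul_assoc]
      _ = _ := by rw [hPSP]
  · simp [Matrix.transpose_mul, hPt, Matrix.mul_assoc]
  · rw [Matrix.mul_assoc, ← hSdef, Matrix.transpose_mul, hPt, hSt, hPS]

/-- The Moore-Penrose inverse: the matrix that satisfies the four Penrose conditions (it is
unique by `IsMoorePenrose.unique`). -/
def moorePenrose (A : Matrix ι κ ℝ) : Matrix κ ι ℝ :=
  (exists_isMoorePenrose A).choose

theorem isMoorePenrose_moorePenrose (A : Matrix ι κ ℝ) : IsMoorePenrose A (moorePenrose A) :=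
  (exists_isMoorePenrose A).choose_spec

theorem IsMoorePenrose.unique {A : Matrix ι κ ℝ} {X Y : Matrix κ ι ℝ}
    (hX : IsMoorePenrose A X) (hY : IsMoorePenrose A Y) : X = Y := by
  obtain ⟨x1, x2, x3, x4⟩ := hX
  obtain ⟨y1, y2, y3, y4⟩ := hY
  have h1 : A * X = A * Y := by
    calc A * X = (A * X).transpose := x3.symm
      _ = ((A * Y) * (A * X)).transpose := by rw [← Matrix.mul_assoc (A * Y), y1]
      _ = A * X * (A * Y) := by rw [Matrix.transpose_mul, x3, y3]
      _ = A * Y := by rw [← Matrix.mul_assoc (A * X), x1]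
  have h2 : X * A = Y * A := by
    calc X * A = (X * A).transpose := x4.symm
      _ = ((X * A) * (Y * A)).transpose := by
          rw [Matrix.mul_assoc X, ← Matrix.mul_assoc A, y1]
      _ = Y * A * (X * A) := by rw [Matrix.transpose_mul, x4, y4]
      _ = Y * A := by rw [Matrix.mul_assoc Y, ← Matrix.mul_assoc A, x1]
  calc X = X * A * X := x2.symm
    _ = Y * A * Y := by rw [h2, Matrix.mul_assoc, h1, Matrix.mul_assoc]
    _ = Y := y2

end MoorePenrose

section DataMatrices

variable {m p N T : ℕ}

/-! The data are `T` input-output trajectories `(ud j, yd j)` of length `N + 1`; the `j`-th one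
is the `j`-th column of the data matrices. -/

/-- Past input data `U_p`. -/
def pastInput (ud : Fin T → Fin (N + 1) → Fin m → ℝ) : Matrix (Fin N × Fin m) (Fin T) ℝ :=
  Matrix.of fun r j => ud j r.1.castSucc r.2

/-- Future (that is, current) input data `U_f`. -/
def futureInput (ud : Fin T → Fin (N + 1) → Fin m → ℝ) : Matrix (Fin m) (Fin T) ℝ :=
  Matrix.of fun a j => ud j (Fin.last N) a

/-- Past output data `Y_p`. -/
def pastOutput (yd : Fin T → Fin (N + 1) → Fin p → ℝ) : Matrix (Fin N × Fin p) (Fin T) ℝ :=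
  Matrix.of fun r j => yd j r.1.castSucc r.2

/-- Future (that is, current) output data `Y_f`. -/
def futureOutput (yd : Fin T → Fin (N + 1) → Fin p → ℝ) : Matrix (Fin p) (Fin T) ℝ :=
  Matrix.of fun i j => yd j (Fin.last N) i

/-- The data matrix `H = [U_p; U_f; Y_p]`. -/
def dataMatrix (ud : Fin T → Fin (N + 1) → Fin m → ℝ) (yd : Fin T → Fin (N + 1) → Fin p → ℝ) :
    Matrix ((Fin N × Fin m) ⊕ (Fin m ⊕ (Fin N × Fin p))) (Fin T) ℝ :=
  Matrix.fromRows (pastInput ud) (Matrix.fromRows (futureInput ud) (pastOutput yd))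

/-- The data matrix `H_i = [U_p; U_f; Y_{p,i}]` of the `i`-th output. -/
def outputDataMatrix (ud : Fin T → Fin (N + 1) → Fin m → ℝ)
    (yd : Fin T → Fin (N + 1) → Fin p → ℝ) (i : Fin p) :
    Matrix ((Fin N × Fin m) ⊕ (Fin m ⊕ Fin N)) (Fin T) ℝ :=
  Matrix.fromRows (pastInput ud) (Matrix.fromRows (futureInput ud)
    ((pastOutput yd).submatrix (fun k => (k, i)) id))

/-- The row vector `Y_{f,i} H_i†`. -/
def predictorRow (ud : Fin T → Fin (N + 1) → Fin m → ℝ)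
    (yd : Fin T → Fin (N + 1) → Fin p → ℝ) (i : Fin p) :
    (Fin N × Fin m) ⊕ (Fin m ⊕ Fin N) → ℝ :=
  Matrix.vecMul (futureOutput yd i) (moorePenrose (outputDataMatrix ud yd i))

/-- The output predicted by recursive use of
`ŷ_i(s) = Y_{f,i} H_i† col(u(s-N:s-1), u(s), ŷ_i(s-N:s-1))` along the input `u`, from the
initial guess `y0`. Time is shifted by `N`: the initial guess sits at the times `0, …, N - 1`
and the prediction starts at time `N`. -/
def predictedOutput (ud : Fin T → Fin (N + 1) → Fin m → ℝ)
    (yd : Fin T → Fin (N + 1) → Fin p → ℝ) (u : ℕ → Fin m → ℝ) (y0 : Fin N → Fin p → ℝ)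
    (s : ℕ) : Fin p → ℝ :=
  if h : s < N then y0 ⟨s, h⟩
  else fun i => predictorRow ud yd i ⬝ᵥ
    Sum.elim (fun r : Fin N × Fin m => u (s - N + r.1) r.2)
      (Sum.elim (u s) (fun k : Fin N => predictedOutput ud yd u y0 (s - N + k) i))
termination_by s
decreasing_by omega

end DataMatrices

end

/-! Fix an output `i`. By elimination of the state, `y_i` obeys a difference equation `P(σ) y_i + ∑
Q_a(σ) u_a = 0` with `P` monic of degree `N`, so `Y_{f,i}` lies in the row space of `H_i` and the
row `K = Y_{f,i} H_i†` reproduces it. By the rank condition the data span all trajectories of length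
`N + 1`, hence `K` predicts exactly along every true trajectory
(`predictorRow_dotProduct_regressor`). The prediction error therefore solves an autonomous
recurrence, whose characteristic polynomial `P_K` is the predictor polynomial, and the free initial
guess makes its initial values arbitrary. So all errors decay iff the roots of `P_K` lie in the open
unit disk.

It remains to compare these roots with the poles of row `i` (`predictorPolynomial_stable_iff`). The
polynomials `P` with `C_i P(A) = 0` form an ideal. It contains `P_K`, and each nonzero element is a
multiple of all denominators of the row; this makes every pole a root of `P_K`. Conversely, let `f`
generate the ideal and write `P_K = f r`. By minimality `f` divides the product of the denominators,
so its roots are poles. The factor `r` is spurious and depends on the data method: the pseudoinverse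
picks the solution orthogonal to the left kernel of `H_i`, which contains the coefficient vectors of
`X ^ j (f, q)`, `j < deg r`, where `(f, q)` is the relation belonging to `f`. Thus `r` is an
orthogonal polynomial for an inner product in which multiplication by `X` is isometric, and Szegő's
argument (`norm_root_lt_one_of_orthogonal`) puts its zeros strictly inside the disk. -/

open Polynomial

/-! ### Linear recurrences -/

/-- The backward shift `(v₀, v₁, …) ↦ (v₁, v₂, …)` on sequences. -/
def seqShift (𝕜 : Type*) [Field 𝕜] : Module.End 𝕜 (ℕ → 𝕜) := LinearMap.funLeft 𝕜 𝕜 Nat.succ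

section Recurrence

variable {𝕜 : Type*} [Field 𝕜]

theorem seqShift_apply (v : ℕ → 𝕜) (t : ℕ) : seqShift 𝕜 v t = v (t + 1) := rfl

theorem seqShift_pow_apply (k : ℕ) (v : ℕ → 𝕜) (t : ℕ) : (seqShift 𝕜 ^ k) v t = v (t + k) := by
  induction k generalizing t with
  | zero => simp
  | succ k ih => rw [pow_succ', Module.End.mul_apply, seqShift_apply, ih]; congr 1; ring

theorem aeval_seqShift_apply {P : 𝕜[X]} {L : ℕ} (hP : P.natDegree ≤ L) (v : ℕ → 𝕜) (t : ℕ) :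
    aeval (seqShift 𝕜) P v t = ∑ k : Fin (L + 1), P.coeff k * v (t + k) := by
  rw [aeval_eq_sum_range' (Nat.lt_succ_of_le hP), LinearMap.sum_apply, Finset.sum_apply,
    Finset.sum_range]
  simp [seqShift_pow_apply]

/-- Solutions of a linear recurrence are determined by their initial values. -/
theorem eq_of_aeval_seqShift_eq_zero {P : 𝕜[X]} (hP : P.Monic) {N : ℕ} (hN : P.natDegree = N)
    {e e' : ℕ → 𝕜} (he : aeval (seqShift 𝕜) P e = 0) (he' : aeval (seqShift 𝕜) P e' = 0)
    (h : ∀ k < N, e k = e' k) : e = e' := by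
  funext s
  induction s using Nat.strong_induction_on with
  | _ s ih =>
    by_cases hs : s < N
    · exact h s hs
    · obtain ⟨t, rfl⟩ := Nat.exists_eq_add_of_le' (not_lt.mp hs)
      have h1 := congrFun (he.trans he'.symm) t
      have hlead : P.coeff N = 1 := hN ▸ hP
      rw [aeval_seqShift_apply hN.le, aeval_seqShift_apply hN.le, Fin.sum_univ_castSucc,
        Fin.sum_univ_castSucc, Finset.sum_congr rfl fun (k : Fin N) _ => by
          rw [Fin.val_castSucc, ih (t + k) (by omega)]] at h1
      simpa [hlead] using h1

end Recurrence

theorem tendsto_zero_of_forced_geometric {z : ℂ} (hz : ‖z‖ < 1) {e f : ℕ → ℂ}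
    (hf : Tendsto f atTop (𝓝 0)) (he : ∀ t, e (t + 1) = z * e t + f t) :
    Tendsto e atTop (𝓝 0) := by
  rw [Metric.tendsto_atTop] at hf ⊢
  intro ε hε
  -- With this bound on the forcing, `ε / 2` is a fixed point of `a ↦ ‖z‖ * a + (1 - ‖z‖) * (ε /
  -- 2)`.
  obtain ⟨t₀, ht₀⟩ := hf ((1 - ‖z‖) * (ε / 2)) (by nlinarith)
  have hbound : ∀ k, ‖e (t₀ + k)‖ ≤ ‖z‖ ^ k * ‖e t₀‖ + ε / 2 := by
    intro k
    induction k with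
    | zero => simp; positivity
    | succ k ih =>
      have h1 : ‖f (t₀ + k)‖ ≤ (1 - ‖z‖) * (ε / 2) := by
        have := ht₀ (t₀ + k) (by omega)
        rw [dist_zero_right] at this
        exact this.le
      calc ‖e (t₀ + k + 1)‖ = ‖z * e (t₀ + k) + f (t₀ + k)‖ := by rw [he]
        _ ≤ ‖z‖ * ‖e (t₀ + k)‖ + ‖f (t₀ + k)‖ := by
          simpa using norm_add_le (z * e (t₀ + k)) (f (t₀ + k))
        _ ≤ ‖z‖ * (‖z‖ ^ k * ‖e t₀‖ + ε / 2) + (1 - ‖z‖) * (ε / 2) := by gcongr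
        _ = ‖z‖ ^ (k + 1) * ‖e t₀‖ + ε / 2 := by ring
  have hgeo : Tendsto (fun k => ‖z‖ ^ k * ‖e t₀‖) atTop (𝓝 0) := by
    simpa using (tendsto_pow_atTop_nhds_zero_of_lt_one (norm_nonneg z) hz).mul_const ‖e t₀‖
  obtain ⟨k₀, hk₀⟩ := (hgeo.eventually (gt_mem_nhds (half_pos hε))).exists_forall_of_atTop
  refine ⟨t₀ + k₀, fun t ht => ?_⟩
  obtain ⟨k, rfl⟩ := Nat.exists_eq_add_of_le (show t₀ ≤ t by omega)
  have h1 := hbound k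
  have h2 := hk₀ k (by omega)
  rw [dist_zero_right]
  linarith

/-- One root is peeled off at a time. The hypothesis asks for decay rather than vanishing so that it
survives the induction: the factors of `s` leave a decaying forcing for the first-order recurrence
of `z`. -/
theorem tendsto_zero_of_recurrence_complex (s : Multiset ℂ) (hs : ∀ z ∈ s, ‖z‖ < 1) (e : ℕ → ℂ)
    (he : Tendsto (aeval (seqShift ℂ) (s.map fun z => X - C z).prod e) atTop (𝓝 0)) :
    Tendsto e atTop (𝓝 0) := by
  induction s using Multiset.induction_on generalizing e with
  | empty => simpa using he
  | cons z s ih =>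
    have hz := hs z (Multiset.mem_cons_self z s)
    rw [Multiset.map_cons, Multiset.prod_cons, mul_comm, map_mul, Module.End.mul_apply] at he
    have h := ih (fun w hw => hs w (Multiset.mem_cons_of_mem hw)) _ he
    refine tendsto_zero_of_forced_geometric hz h fun t => ?_
    simp [seqShift_apply, Module.algebraMap_end_apply]

theorem aeval_seqShift_ofReal (P : ℝ[X]) (e : ℕ → ℝ) :
    aeval (seqShift ℂ) (P.map (algebraMap ℝ ℂ)) (fun t => (e t : ℂ)) =
      fun t => ((aeval (seqShift ℝ) P e t : ℝ) : ℂ) := by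
  funext t
  rw [aeval_seqShift_apply (natDegree_map_le), aeval_seqShift_apply le_rfl]
  simp

/-- Solutions of a linear recurrence with Schur stable characteristic polynomial decay. -/
theorem tendsto_zero_of_recurrence {P : ℝ[X]} (hP : P.Monic)
    (hroots : ∀ z : ℂ, aeval z P = 0 → ‖z‖ < 1) {e : ℕ → ℝ} (he : aeval (seqShift ℝ) P e = 0) :
    Tendsto e atTop (𝓝 0) := by
  have hm : (P.map (algebraMap ℝ ℂ)).Monic := hP.map _
  have hprod := (IsAlgClosed.splits (P.map (algebraMap ℝ ℂ))).eq_prod_roots_of_monic hm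
  have h := tendsto_zero_of_recurrence_complex (P.map (algebraMap ℝ ℂ)).roots (fun z hz => by
      apply hroots
      have := (mem_roots'.mp hz).2
      rwa [IsRoot, eval_map_algebraMap] at this) (fun t => (e t : ℂ)) (by
      rw [← hprod, aeval_seqShift_ofReal, he]
      simp)
  have h2 := (Complex.continuous_re.tendsto 0).comp h
  simpa [Function.comp_def] using h2

/-- If all solutions of a linear recurrence decay, its characteristic polynomial is
Schur stable. -/
theorem norm_root_lt_one_of_recurrence {P : ℝ[X]}
    (h : ∀ e : ℕ → ℝ, aeval (seqShift ℝ) P e = 0 → Tendsto e atTop (𝓝 0)) {z : ℂ}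
    (hz : aeval z P = 0) : ‖z‖ < 1 := by
  have hpow : ∀ t : ℕ, ∑ k : Fin (P.natDegree + 1), (P.coeff k : ℂ) * z ^ (t + (k : ℕ)) = 0 := by
    intro t
    have h1 : ∑ k : Fin (P.natDegree + 1), (P.coeff k : ℂ) * z ^ (k : ℕ) = 0 := by
      rw [← hz, aeval_eq_sum_range, Finset.sum_range]
      simp [Algebra.smul_def]
    calc _ = z ^ t * ∑ k : Fin (P.natDegree + 1), (P.coeff k : ℂ) * z ^ (k : ℕ) := by
          rw [Finset.mul_sum]
          exact Finset.sum_congr rfl fun k _ => by ring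
      _ = 0 := by rw [h1, mul_zero]
  -- Since `P` has real coefficients, the real and imaginary parts of `z ^ t` are real solutions.
  have hre : Tendsto (fun t => (z ^ t).re) atTop (𝓝 0) := h _ (by
    funext t
    rw [aeval_seqShift_apply le_rfl]
    simpa using congrArg Complex.re (hpow t))
  have him : Tendsto (fun t => (z ^ t).im) atTop (𝓝 0) := h _ (by
    funext t
    rw [aeval_seqShift_apply le_rfl]
    simpa using congrArg Complex.im (hpow t))
  have hsq : Tendsto (fun t => (z ^ t).re ^ 2 + (z ^ t).im ^ 2) atTop (𝓝 0) := by
    simpa using (hre.pow 2).add (him.pow 2)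
  by_contra! hge
  refine absurd (le_of_tendsto_of_tendsto' tendsto_const_nhds hsq (fun t => ?_))
    (not_le_of_gt one_pos)
  have : 1 ≤ ‖z ^ t‖ ^ 2 := by
    rw [norm_pow, ← pow_mul]
    exact one_le_pow₀ hge
  rw [← Complex.normSq_eq_norm_sq, Complex.normSq_apply] at this
  nlinarith

/-! ### Zeros of orthogonal polynomials -/

section Szego

variable {ι : Type*} [Fintype ι]

/-- The vector of the coefficients up to degree `N` of the products `s * f i`. -/
noncomputable def productCoeffs (f : ι → ℝ[X]) (N : ℕ) (s : ℂ[X]) : EuclideanSpace ℂ (ι × Fin (N + 1)) :=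
  WithLp.toLp 2 fun w => (s * (f w.1).map (algebraMap ℝ ℂ)).coeff w.2

theorem norm_sq_productCoeffs (f : ι → ℝ[X]) (N : ℕ) (s : ℂ[X]) :
    ‖productCoeffs f N s‖ ^ 2 = ∑ i, ∑ k : Fin (N + 1),
      ‖(s * (f i).map (algebraMap ℝ ℂ)).coeff k‖ ^ 2 := by
  rw [EuclideanSpace.norm_sq_eq, Fintype.sum_prod_type]
  rfl

/-- Multiplication by `X` shifts the coefficients by one place; the degree bound ensures that
nothing is pushed out of the window `0, …, N`. -/
theorem norm_sq_productCoeffs_X_mul {f : ι → ℝ[X]} {N d : ℕ} (hf : ∀ i, (f i).natDegree ≤ d)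
    {s : ℂ[X]} (hs : s.natDegree + d < N) :
    ‖productCoeffs f N (X * s)‖ ^ 2 = ‖productCoeffs f N s‖ ^ 2 := by
  simp only [norm_sq_productCoeffs]
  refine Finset.sum_congr rfl fun i _ => ?_
  rw [Fin.sum_univ_succ, Fin.sum_univ_castSucc]
  have h0 : (s * (f i).map (algebraMap ℝ ℂ)).coeff N = 0 := by
    apply coeff_eq_zero_of_natDegree_lt
    have h1 := natDegree_mul_le (p := s) (q := (f i).map (algebraMap ℝ ℂ))
    have h2 := natDegree_map_le (p := f i) (f := algebraMap ℝ ℂ)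
    have h3 := hf i
    omega
  simp [mul_assoc, coeff_X_mul, h0]

/-- A real monic polynomial `r` of degree `M` such that the coefficients of `(r * f i)_i` are
orthogonal to those of `(X ^ j * f i)_i` for all `j < M` has its zeros in the open unit disk. -/
theorem norm_root_lt_one_of_orthogonal {f : ι → ℝ[X]} {d M : ℕ} (hf : ∀ i, (f i).natDegree ≤ d)
    {i₀ : ι} (hi₀ : f i₀ ≠ 0) {r : ℝ[X]} (hr : r ≠ 0) (hrM : r.natDegree = M)
    {N : ℕ} (hN : M + d = N) (horth : ∀ j < M, ∑ i, ∑ k : Fin (N + 1),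
      (r * f i).coeff k * (X ^ j * f i).coeff k = 0)
    {z : ℂ} (hz : aeval z r = 0) : ‖z‖ < 1 := by
  subst hN
  set ρ : ℂ[X] := r.map (algebraMap ℝ ℂ) with hρ
  have hρ0 : ρ ≠ 0 := (Polynomial.map_ne_zero_iff (algebraMap ℝ ℂ).injective).mpr hr
  have hroot : IsRoot ρ z := by rw [IsRoot, hρ, eval_map_algebraMap, hz]
  obtain ⟨s, hs⟩ := dvd_iff_isRoot.mpr hroot
  have hs0 : s ≠ 0 := by
    rintro rfl
    exact hρ0 (by rw [hs, mul_zero])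
  have hdeg : s.natDegree + 1 = M := by
    have h1 : ρ.natDegree = M := by rw [hρ, natDegree_map, hrM]
    rw [hs, natDegree_mul (X_sub_C_ne_zero z) hs0, natDegree_X_sub_C] at h1
    omega
  -- This is `X s = z s + ρ`, from `ρ = (X - z) s`.
  have hsum : productCoeffs f (M + d) (X * s) =
      z • productCoeffs f (M + d) s + productCoeffs f (M + d) ρ := by
    ext w
    simp only [productCoeffs, hs, PiLp.add_apply, PiLp.smul_apply, smul_eq_mul]
    rw [← coeff_C_mul, ← coeff_add]
    congr 1
    ring
  have hscoeff : ∀ i (k : ℕ), (s * (f i).map (algebraMap ℝ ℂ)).coeff k =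
      ∑ j ∈ Finset.range M, s.coeff j * (((X ^ j * f i).coeff k : ℝ) : ℂ) := by
    intro i k
    conv_lhs => rw [as_sum_range' s M (by omega), Finset.sum_mul, finsetSum_coeff]
    refine Finset.sum_congr rfl fun j _ => ?_
    rw [← C_mul_X_pow_eq_monomial, mul_assoc, coeff_C_mul]
    congr 1
    have : (X ^ j * (f i).map (algebraMap ℝ ℂ)) = (X ^ j * f i).map (algebraMap ℝ ℂ) := by simp
    rw [this, coeff_map]
    rfl
  -- As `deg s < M`, the vector of `s` is a combination of those of `X ^ j`, `j < M`, to which `ρ`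
  -- is orthogonal.
  have hinner : inner ℂ (productCoeffs f (M + d) ρ) (productCoeffs f (M + d) s) = 0 := by
    rw [PiLp.inner_apply, Fintype.sum_prod_type]
    have hterm : ∀ i (k : Fin (M + d + 1)),
        inner ℂ (productCoeffs f (M + d) ρ (i, k)) (productCoeffs f (M + d) s (i, k)) =
        ∑ j ∈ Finset.range M, s.coeff j *
          (((r * f i).coeff k * (X ^ j * f i).coeff k : ℝ) : ℂ) := by
      intro i k
      have h1 : productCoeffs f (M + d) ρ (i, k) = (((r * f i).coeff k : ℝ) : ℂ) := by
        simp only [productCoeffs, hρ, ← Polynomial.map_mul, coeff_map]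
        rfl
      have h2 : productCoeffs f (M + d) s (i, k) =
        (s * (f i).map (algebraMap ℝ ℂ)).coeff k := rfl
      rw [h1, h2, hscoeff, RCLike.inner_apply, Finset.sum_mul]
      refine Finset.sum_congr rfl fun j _ => ?_
      rw [Complex.conj_ofReal]
      push_cast
      ring
    simp only [hterm]
    calc _ = ∑ j ∈ Finset.range M, s.coeff j * ((∑ i, ∑ k : Fin (M + d + 1),
          (r * f i).coeff k * (X ^ j * f i).coeff k : ℝ) : ℂ) := by
          push_cast
          simp only [Finset.mul_sum]
          conv_rhs => rw [Finset.sum_comm]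
          exact Finset.sum_congr rfl fun i _ => Finset.sum_comm
      _ = 0 := Finset.sum_eq_zero fun j hj => by
          rw [horth j (Finset.mem_range.mp hj)]
          simp
  -- By the isometry the left side is also `‖s‖ ^ 2`, so `(1 - ‖z‖ ^ 2) ‖s‖ ^ 2 = ‖ρ‖ ^ 2`, which is
  -- positive because `f i₀ ≠ 0`.
  have hpyth : ‖productCoeffs f (M + d) (X * s)‖ ^ 2 =
      ‖z‖ ^ 2 * ‖productCoeffs f (M + d) s‖ ^ 2 + ‖productCoeffs f (M + d) ρ‖ ^ 2 := by
    have h0 : inner ℂ (z • productCoeffs f (M + d) s) (productCoeffs f (M + d) ρ) = 0 := by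
      rw [inner_smul_left, inner_eq_zero_symm.mp hinner, mul_zero]
    rw [hsum, sq, norm_add_sq_eq_norm_sq_add_norm_sq_of_inner_eq_zero _ _ h0, norm_smul]
    ring
  rw [norm_sq_productCoeffs_X_mul hf (by omega)] at hpyth
  have hpos : 0 < ‖productCoeffs f (M + d) ρ‖ ^ 2 := by
    have hne : r * f i₀ ≠ 0 := mul_ne_zero hr hi₀
    have hlt : (r * f i₀).natDegree < M + d + 1 := by
      have h1 := natDegree_mul_le (p := r) (q := f i₀)
      have h2 := hf i₀
      omega
    have hv : productCoeffs f (M + d) ρ ≠ 0 := by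
      intro h
      have h1 := congrArg (fun v => v (i₀, (⟨_, hlt⟩ : Fin (M + d + 1)))) h
      simp only [productCoeffs, hρ, ← Polynomial.map_mul, coeff_map, PiLp.zero_apply] at h1
      rw [map_eq_zero] at h1
      exact hne (leadingCoeff_eq_zero.mp h1)
    positivity
  by_contra! hge
  have h1 : 1 ≤ ‖z‖ ^ 2 := one_le_pow₀ hge
  nlinarith [sq_nonneg ‖productCoeffs f (M + d) s‖]

end Szego

/-! ### Elimination of the state -/

/-- Eliminating the state `x` of `φ x = A x + B u`: for every polynomial `P`, the vector
`P(φ) (c x)` is `c P(A) x` plus a polynomial in `φ` applied to `u`. -/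
theorem exists_state_elimination {m n : ℕ} (A : Matrix (Fin n) (Fin n) ℝ)
    (B : Matrix (Fin n) (Fin m) ℝ) (L : ℕ) (P : ℝ[X]) (hP : P.natDegree ≤ L) (c : Fin n → ℝ) :
    ∃ Q : Fin m → ℝ[X], (∀ a, (Q a).degree < L) ∧
      ∀ (M : Type) [AddCommGroup M] [Module ℝ M] (φ : Module.End ℝ M) (x : Fin n → M)
        (u : Fin m → M), (∀ s, φ (x s) = ∑ s', A s s' • x s' + ∑ a, B s a • u a) →
        aeval φ P (∑ s, c s • x s) =
          ∑ s, Matrix.vecMul c (aeval A P) s • x s + ∑ a, aeval φ (Q a) (u a) := by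
  -- Write `P = X * P.divX + P(0)` and use `φ (c x) = (c A) x + (c B) u`: one power of `φ` moves
  -- onto the row `c`. The resulting `Q` does not depend on the module, so it serves both for
  -- sequences with the shift and for rational functions with multiplication by `z`.
  induction L generalizing P c with
  | zero =>
    obtain ⟨b, rfl⟩ := natDegree_eq_zero.mp (Nat.le_zero.mp hP)
    refine ⟨0, fun a => by simp, fun M _ _ φ x u _ => ?_⟩
    simp [Algebra.algebraMap_eq_smul_one, Matrix.vecMul_smul, mul_smul, smul_comm b]
  | succ L ih =>
    obtain ⟨Q, hQ, h⟩ := ih P.divX (by rw [natDegree_divX_eq_natDegree_tsub_one]; omega)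
      (Matrix.vecMul c A)
    refine ⟨fun a => Q a + P.divX * C (Matrix.vecMul c B a), fun a => ?_,
      fun M _ _ φ x u hx => ?_⟩
    · rw [degree_lt_iff_coeff_zero]
      intro k hk
      rw [coeff_add, coeff_mul_C, (degree_lt_iff_coeff_zero _ _).mp (hQ a) k (by omega),
        coeff_eq_zero_of_natDegree_lt (by rw [natDegree_divX_eq_natDegree_tsub_one]; omega)]
      simp
    · have h1 : φ (∑ s, c s • x s) =
          ∑ s, Matrix.vecMul c A s • x s + ∑ a, Matrix.vecMul c B a • u a := by
        simp only [map_sum, map_smul, hx, smul_add, Finset.sum_add_distrib, Finset.smul_sum,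
          Matrix.vecMul, dotProduct, Finset.sum_smul, mul_smul]
        congr 1 <;> exact Finset.sum_comm
      have h2 : ∀ s, Matrix.vecMul c (aeval A P) s =
          Matrix.vecMul (Matrix.vecMul c A) (aeval A P.divX) s + P.coeff 0 * c s := by
        intro s
        have h3 : aeval A P = A * aeval A P.divX + P.coeff 0 • 1 := by
          conv_lhs => rw [← divX_mul_X_add P, mul_comm]
          simp only [map_add, map_mul, aeval_X, aeval_C, Algebra.algebraMap_eq_smul_one]
        rw [h3, Matrix.vecMul_add, Matrix.vecMul_smul, Matrix.vecMul_one, Matrix.vecMul_vecMul]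
        rfl
      have h4 : ∀ v, aeval φ P v = aeval φ P.divX (φ v) + P.coeff 0 • v := by
        intro v
        conv_lhs => rw [← divX_mul_X_add P]
        simp [Module.End.mul_apply, Module.algebraMap_end_apply]
      rw [h4, h1, map_add, h M φ x u hx]
      simp only [map_add, map_mul, LinearMap.add_apply, Module.End.mul_apply, aeval_C, h2,
        add_smul, Finset.sum_add_distrib, map_sum, map_smul, Module.algebraMap_end_apply,
        mul_smul, Finset.smul_sum]
      abel

/-! ### Transfer matrices -/

namespace StateSpace

variable {m p n : ℕ}

/-- The pencil `z I - A` over the rational functions. -/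
noncomputable def pencil {n : ℕ} (A : Matrix (Fin n) (Fin n) ℝ) :
    Matrix (Fin n) (Fin n) (RatFunc ℝ) :=
  Matrix.scalar (Fin n) (RatFunc.X : RatFunc ℝ) - A.map RatFunc.C

theorem isUnit_det_pencil {n : ℕ} (A : Matrix (Fin n) (Fin n) ℝ) : IsUnit (pencil A).det := by
  have h : pencil A = (algebraMap ℝ[X] (RatFunc ℝ)).mapMatrix (Matrix.charmatrix A) := by
    ext i j
    by_cases hij : i = j
    · subst hij
      simp [pencil, Matrix.charmatrix, RatFunc.algebraMap_X, RatFunc.algebraMap_C]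
    · simp [pencil, Matrix.charmatrix, RatFunc.algebraMap_C, hij]
  rw [h, ← RingHom.map_det, isUnit_iff_ne_zero]
  exact (map_ne_zero_iff _ (RatFunc.algebraMap_injective ℝ)).mpr A.charpoly_monic.ne_zero

/-- The input-to-state transfer matrix `(z I - A)⁻¹ B`. -/
noncomputable def stateTransfer (S : StateSpace m p n) : Matrix (Fin n) (Fin m) (RatFunc ℝ) :=
  (pencil S.A)⁻¹ * S.B.map RatFunc.C

theorem transferMatrix_eq (S : StateSpace m p n) :
    S.transferMatrix = S.C.map RatFunc.C * S.stateTransfer + S.D.map RatFunc.C := by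
  rw [transferMatrix, stateTransfer, pencil, Matrix.mul_assoc]

/-- Column `j` of `(z I - A)⁻¹ B` solves the state equation with multiplication by `z` as the shift
and the `j`-th unit vector as input; this is the form required by `exists_state_elimination`. -/
theorem X_mul_stateTransfer (S : StateSpace m p n) (s : Fin n) (j : Fin m) :
    RatFunc.X * S.stateTransfer s j =
      ∑ s', S.A s s' • S.stateTransfer s' j +
        ∑ a, S.B s a • (Pi.single j 1 : Fin m → RatFunc ℝ) a := by
  have h : pencil S.A * S.stateTransfer = S.B.map RatFunc.C := by
    rw [stateTransfer, Matrix.mul_nonsing_inv_cancel_left _ _ (isUnit_det_pencil S.A)]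
  have h2 := congrFun (congrFun h s) j
  rw [pencil, Matrix.sub_mul, Matrix.sub_apply, sub_eq_iff_eq_add] at h2
  simp only [Matrix.scalar_apply, Matrix.diagonal_mul, Matrix.map_apply] at h2
  rw [h2, Matrix.mul_apply, add_comm]
  congr 1
  · exact Finset.sum_congr rfl fun s' _ => by rw [Matrix.map_apply, RatFunc.smul_eq_C_mul]
  · rw [Finset.sum_eq_single j (by simp +contextual) (by simp)]
    simp [RatFunc.smul_eq_C_mul]

theorem aeval_mulLeft_X (P : ℝ[X]) (v : RatFunc ℝ) :
    aeval (LinearMap.mulLeft ℝ (RatFunc.X : RatFunc ℝ)) P v = algebraMap ℝ[X] (RatFunc ℝ) P * v := by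
  have h : LinearMap.mulLeft ℝ (RatFunc.X : RatFunc ℝ) = Algebra.lmul ℝ (RatFunc ℝ) RatFunc.X := rfl
  rw [h, aeval_algHom_apply]
  have h2 : aeval (RatFunc.X : RatFunc ℝ) P = algebraMap ℝ[X] (RatFunc ℝ) P := by
    rw [← RatFunc.algebraMap_X, aeval_algebraMap_apply]
    simp
  rw [h2]
  rfl

theorem exists_stateTransfer_elimination (S : StateSpace m p n) (L : ℕ) (P : ℝ[X])
    (hP : P.natDegree ≤ L) (c : Fin n → ℝ) :
    ∃ Q : Fin m → ℝ[X], (∀ a, (Q a).degree < L) ∧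
      ∀ j, algebraMap ℝ[X] (RatFunc ℝ) P * ∑ s, c s • S.stateTransfer s j =
        ∑ s, Matrix.vecMul c (aeval S.A P) s • S.stateTransfer s j +
          algebraMap ℝ[X] (RatFunc ℝ) (Q j) := by
  obtain ⟨Q, hQ, h⟩ := exists_state_elimination S.A S.B L P hP c
  refine ⟨Q, hQ, fun j => ?_⟩
  have h2 := h (RatFunc ℝ) (LinearMap.mulLeft ℝ RatFunc.X) (fun s => S.stateTransfer s j)
    (Pi.single j 1) (fun s => S.X_mul_stateTransfer s j)
  simp only [aeval_mulLeft_X] at h2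
  rw [h2]
  congr 1
  rw [Finset.sum_eq_single j (by simp +contextual) (by simp)]
  simp

theorem transferMatrix_apply (S : StateSpace m p n) (i : Fin p) (j : Fin m) :
    S.transferMatrix i j = ∑ s, S.C i s • S.stateTransfer s j + RatFunc.C (S.D i j) := by
  rw [transferMatrix_eq, Matrix.add_apply, Matrix.mul_apply]
  simp [RatFunc.smul_eq_C_mul]

/-- A polynomial `P` with `C_i P(A) = 0` clears the denominators of the `i`-th row of the transfer
matrix. -/
theorem exists_mul_transferMatrix_eq (S : StateSpace m p n) (i : Fin p) {P : ℝ[X]}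
    (hP : Matrix.vecMul (S.C i) (aeval S.A P) = 0) (j : Fin m) :
    ∃ Q : ℝ[X], algebraMap ℝ[X] (RatFunc ℝ) P * S.transferMatrix i j =
      algebraMap ℝ[X] (RatFunc ℝ) Q := by
  obtain ⟨Q, -, h⟩ := S.exists_stateTransfer_elimination _ P le_rfl (S.C i)
  refine ⟨Q j + P * Polynomial.C (S.D i j), ?_⟩
  rw [transferMatrix_apply, mul_add, h j, hP]
  simp [RatFunc.algebraMap_C]

/-- If a row vector `c` makes `c (z I - A)⁻¹ B` polynomial, then it is zero. -/
theorem sum_smul_stateTransfer_eq_zero (S : StateSpace m p n) {c : Fin n → ℝ}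
    {j : Fin m} {R : ℝ[X]} (h : ∑ s, c s • S.stateTransfer s j = algebraMap ℝ[X] (RatFunc ℝ) R) :
    ∑ s, c s • S.stateTransfer s j = 0 := by
  -- By Cayley–Hamilton the state term drops out, leaving `χ R = Q` with `deg Q < n = deg χ`; this
  -- forces `R = 0`.
  obtain ⟨Q, hQ, hQ2⟩ := S.exists_stateTransfer_elimination n S.A.charpoly
    (by rw [Matrix.charpoly_natDegree_eq_dim, Fintype.card_fin]) c
  have h1 := hQ2 j
  rw [Matrix.aeval_self_charpoly, h] at h1
  simp only [Matrix.vecMul_zero, Pi.zero_apply, zero_smul, Finset.sum_const_zero, zero_add] at h1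
  rw [← map_mul] at h1
  have h2 := RatFunc.algebraMap_injective ℝ h1
  have h3 : R = 0 := by
    by_contra hR
    have h4 := hQ j
    rw [← h2, degree_mul, Matrix.charpoly_degree_eq_dim, Fintype.card_fin,
      degree_eq_natDegree hR] at h4
    norm_cast at h4
    omega
  rw [h, h3, map_zero]

/-- A row vector `c` that makes `c (z I - A)⁻¹ B` polynomial annihilates all `A ^ k B`. -/
theorem vecMul_pow_mul_eq_zero (S : StateSpace m p n) (k : ℕ) {c : Fin n → ℝ}
    (h : ∀ j, ∃ R : ℝ[X], ∑ s, c s • S.stateTransfer s j = algebraMap ℝ[X] (RatFunc ℝ) R) :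
    Matrix.vecMul c (S.A ^ k * S.B) = 0 := by
  -- Multiplying the vanishing `c (z I - A)⁻¹ B` by `z` gives `0 = c A (z I - A)⁻¹ B + c B`. Hence
  -- `c A` satisfies the same hypothesis, with a constant polynomial that must itself vanish, so
  -- that `c B = 0`.
  have key : ∀ {c : Fin n → ℝ},
      (∀ j, ∃ R : ℝ[X], ∑ s, c s • S.stateTransfer s j = algebraMap ℝ[X] (RatFunc ℝ) R) →
      ∀ j, ∑ s, Matrix.vecMul c S.A s • S.stateTransfer s j =
        algebraMap ℝ[X] (RatFunc ℝ) (Polynomial.C (-Matrix.vecMul c S.B j)) := by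
    intro c h j
    obtain ⟨R, hR⟩ := h j
    have h0 := S.sum_smul_stateTransfer_eq_zero hR
    have h1 : RatFunc.X * ∑ s, c s • S.stateTransfer s j =
        ∑ s, Matrix.vecMul c S.A s • S.stateTransfer s j + RatFunc.C (Matrix.vecMul c S.B j) := by
      rw [Finset.mul_sum]
      simp only [mul_smul_comm, X_mul_stateTransfer, smul_add, Finset.sum_add_distrib]
      congr 1
      · simp only [Finset.smul_sum, Matrix.vecMul, dotProduct, Finset.sum_smul, mul_smul]
        exact Finset.sum_comm
      · simp only [Matrix.vecMul, dotProduct, map_sum]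
        refine Finset.sum_congr rfl fun s _ => ?_
        rw [Finset.sum_eq_single j (by simp +contextual) (by simp)]
        simp [RatFunc.smul_eq_C_mul]
    rw [h0, mul_zero] at h1
    rw [RatFunc.algebraMap_C, map_neg]
    exact eq_neg_of_add_eq_zero_left h1.symm
  induction k generalizing c with
  | zero =>
    rw [pow_zero, Matrix.one_mul]
    funext j
    have h1 := S.sum_smul_stateTransfer_eq_zero (key h j)
    rw [key h j] at h1
    have h2 := RatFunc.algebraMap_injective ℝ (h1.trans (map_zero _).symm)
    simpa using h2
  | succ k ih =>
    rw [pow_succ', Matrix.mul_assoc, ← Matrix.vecMul_vecMul]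
    exact ih fun j => ⟨_, key h j⟩

/-- A minimal realization is controllable. -/
theorem IsMinimal.eq_zero_of_vecMul_eq_zero {S : StateSpace m p n} (hS : S.IsMinimal)
    {c : Fin n → ℝ} (hc : ∀ k, Matrix.vecMul c (S.A ^ k * S.B) = 0) : c = 0 := by
  by_contra hne
  -- `W` is the reachable subspace. It is proper, as `c` is orthogonal to it, and restricting the
  -- system to it gives a realization with fewer states.
  set W : Submodule ℝ (Fin n → ℝ) :=
    Submodule.span ℝ (Set.range fun w : ℕ × Fin m => (S.A ^ w.1 * S.B).col w.2) with hW
  have hWc : ∀ v ∈ W, c ⬝ᵥ v = 0 := by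
    intro v hv
    induction hv using Submodule.span_induction with
    | mem v hv =>
      obtain ⟨w, rfl⟩ := hv
      exact congrFun (hc w.1) w.2
    | zero => simp
    | add v w _ _ hv hw => rw [dotProduct_add, hv, hw, add_zero]
    | smul a v _ hv => rw [dotProduct_smul, hv, smul_zero]
  have hWtop : W ≠ ⊤ := by
    intro h
    have h1 := hWc c (h ▸ Submodule.mem_top)
    exact hne (dotProduct_self_eq_zero.mp h1)
  have hlt : Module.finrank ℝ W < n := by
    simpa using Submodule.finrank_lt hWtop
  have hWA : ∀ v ∈ W, S.A.mulVec v ∈ W := by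
    intro v hv
    induction hv using Submodule.span_induction with
    | mem v hv =>
      obtain ⟨w, rfl⟩ := hv
      refine Submodule.subset_span ⟨(w.1 + 1, w.2), ?_⟩
      funext s
      simp only [pow_succ', Matrix.mul_assoc S.A]
      rfl
    | zero => simp
    | add v w _ _ hv hw => rw [Matrix.mulVec_add]; exact W.add_mem hv hw
    | smul a v _ hv => rw [Matrix.mulVec_smul]; exact W.smul_mem a hv
  have hWB : ∀ j, S.B.col j ∈ W := fun j => Submodule.subset_span ⟨(0, j), by simp⟩
  set r := Module.finrank ℝ W
  let b : Module.Basis (Fin r) ℝ W := Module.finBasis ℝ W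
  let V : Matrix (Fin n) (Fin r) ℝ := Matrix.of fun s k => (b k : Fin n → ℝ) s
  have hrep : ∀ v (hv : v ∈ W), V.mulVec (b.repr ⟨v, hv⟩) = v := by
    intro v hv
    have h1 := congrArg Subtype.val (b.sum_repr ⟨v, hv⟩)
    simp only [Submodule.coe_sum, Submodule.coe_smul] at h1
    conv_rhs => rw [← h1]
    funext s
    simp [V, Matrix.mulVec, dotProduct, mul_comm]
  let Ar : Matrix (Fin r) (Fin r) ℝ :=
    Matrix.of fun k' k => b.repr ⟨S.A.mulVec (b k), hWA _ (b k).2⟩ k'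
  let Br : Matrix (Fin r) (Fin m) ℝ := Matrix.of fun k' j => b.repr ⟨S.B.col j, hWB j⟩ k'
  have hA : S.A * V = V * Ar := by
    ext s k
    exact (congrFun (hrep _ (hWA _ (b k).2)) s).symm
  have hB : S.B = V * Br := by
    ext s j
    exact (congrFun (hrep _ (hWB j)) s).symm
  let Sr : StateSpace m p r := ⟨Ar, Br, S.C * V, S.D⟩
  -- The inclusion `V` of `W` intertwines the two pencils, hence also their inverses, so the
  -- transfer matrix is unchanged.
  have hmul : pencil S.A * V.map RatFunc.C = V.map RatFunc.C * pencil Ar := by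
    have h1 : S.A.map RatFunc.C * V.map RatFunc.C = V.map RatFunc.C * Ar.map RatFunc.C := by
      rw [← Matrix.map_mul, hA, Matrix.map_mul]
    rw [pencil, pencil, Matrix.sub_mul, Matrix.mul_sub, h1]
    congr 1
    ext s k
    simp [mul_comm]
  have hinv : V.map RatFunc.C * (pencil Ar)⁻¹ = (pencil S.A)⁻¹ * V.map RatFunc.C := by
    calc _ = (pencil S.A)⁻¹ * (pencil S.A * V.map RatFunc.C) * (pencil Ar)⁻¹ := by
          rw [Matrix.nonsing_inv_mul_cancel_left _ _ (isUnit_det_pencil S.A)]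
      _ = _ := by
          rw [hmul, Matrix.mul_assoc, Matrix.mul_nonsing_inv_cancel_right _ _
            (isUnit_det_pencil Ar)]
  have htr : Sr.transferMatrix = S.transferMatrix := by
    have h1 : V.map RatFunc.C * Sr.stateTransfer = S.stateTransfer := by
      rw [stateTransfer, stateTransfer, ← Matrix.mul_assoc, hinv, Matrix.mul_assoc,
        ← Matrix.map_mul, hB]
    rw [transferMatrix_eq, transferMatrix_eq, ← h1, ← Matrix.mul_assoc, ← Matrix.map_mul]
  have hle : minimalOrder S.transferMatrix ≤ r := Nat.sInf_le ⟨Sr, htr⟩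
  rw [hS] at hle
  omega

/-- For a minimal realization, a polynomial `P` that clears the denominators of the `i`-th row of
the transfer matrix satisfies `C_i P(A) = 0`. -/
theorem IsMinimal.vecMul_aeval_eq_zero {S : StateSpace m p n} (hS : S.IsMinimal) (i : Fin p)
    {P : ℝ[X]} (hP : ∀ j, ∃ R : ℝ[X],
      algebraMap ℝ[X] (RatFunc ℝ) P * S.transferMatrix i j = algebraMap ℝ[X] (RatFunc ℝ) R) :
    Matrix.vecMul (S.C i) (aeval S.A P) = 0 := by
  refine hS.eq_zero_of_vecMul_eq_zero fun k => S.vecMul_pow_mul_eq_zero k fun j => ?_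
  obtain ⟨Q, -, h⟩ := S.exists_stateTransfer_elimination _ P le_rfl (S.C i)
  obtain ⟨R, hR⟩ := hP j
  -- Elimination gives `C_i P(A) (z I - A)⁻¹ B = P G_i - P D_i - Q`, which is polynomial by
  -- hypothesis.
  refine ⟨R - P * Polynomial.C (S.D i j) - Q j, ?_⟩
  rw [transferMatrix_apply, mul_add, h j] at hR
  rw [map_sub, map_sub, ← hR, map_mul, RatFunc.algebraMap_C]
  ring

/-- A row of the transfer matrix has a common denominator whose degree is the minimal order of the
row. -/
theorem IsMinimal.exists_monic_vecMul_aeval_eq_zero {S : StateSpace m p n} (hS : S.IsMinimal)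
    (i : Fin p) :
    ∃ P : ℝ[X], P.Monic ∧ P.natDegree = minimalOrder (outputRow S.transferMatrix i) ∧
      Matrix.vecMul (S.C i) (aeval S.A P) = 0 := by
  have hne : {k | ∃ R : StateSpace m 1 k,
      R.transferMatrix = outputRow S.transferMatrix i}.Nonempty := by
    refine ⟨n, ⟨S.A, S.B, S.C.submatrix (fun _ => i) id, S.D.submatrix (fun _ => i) id⟩, ?_⟩
    ext a j
    simp only [transferMatrix_apply, outputRow, Matrix.submatrix_apply]
    rfl
  obtain ⟨R, hR⟩ := Nat.sInf_mem hne
  -- By Cayley–Hamilton the characteristic polynomial of a minimal realization of the row clears its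
  -- denominators.
  refine ⟨R.A.charpoly, R.A.charpoly_monic, ?_, ?_⟩
  · rw [Matrix.charpoly_natDegree_eq_dim, Fintype.card_fin]
    rfl
  · refine hS.vecMul_aeval_eq_zero i fun j => ?_
    have h := R.exists_mul_transferMatrix_eq 0 (P := R.A.charpoly)
      (by rw [Matrix.aeval_self_charpoly, Matrix.vecMul_zero]) j
    rwa [hR] at h

/-- The ideal of the polynomials `P` with `C_i P(A) = 0`. -/
def outputAnnihilator (S : StateSpace m p n) (i : Fin p) : Ideal ℝ[X] where
  carrier := {P | Matrix.vecMul (S.C i) (aeval S.A P) = 0}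
  zero_mem' := by simp
  add_mem' {P Q} hP hQ := by
    simp only [Set.mem_ofPred_eq] at hP hQ ⊢
    rw [map_add, Matrix.vecMul_add, hP, hQ, add_zero]
  smul_mem' R P hP := by
    simp only [Set.mem_ofPred_eq] at hP ⊢
    rw [smul_eq_mul, mul_comm, map_mul, ← Matrix.vecMul_vecMul, hP, Matrix.zero_vecMul]

theorem mem_outputAnnihilator {S : StateSpace m p n} {i : Fin p} {P : ℝ[X]} :
    P ∈ S.outputAnnihilator i ↔ Matrix.vecMul (S.C i) (aeval S.A P) = 0 := Iff.rfl

theorem denom_dvd_of_mem_outputAnnihilator {S : StateSpace m p n} {i : Fin p} {P : ℝ[X]}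
    (hP : P ∈ S.outputAnnihilator i) (hP0 : P ≠ 0) (j : Fin m) :
    (S.transferMatrix i j).denom ∣ P := by
  obtain ⟨Q, hQ⟩ := S.exists_mul_transferMatrix_eq i hP j
  rw [RatFunc.denom_dvd hP0]
  refine ⟨Q, ?_⟩
  rw [eq_div_iff ((map_ne_zero_iff _ (RatFunc.algebraMap_injective ℝ)).mpr hP0), ← hQ, mul_comm]

/-- Minimality excludes hidden modes, so clearing denominators already annihilates. The product is
used instead of the least common multiple since only its roots matter. -/
theorem IsMinimal.prod_denom_mem_outputAnnihilator {S : StateSpace m p n} (hS : S.IsMinimal)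
    (i : Fin p) : ∏ j, (S.transferMatrix i j).denom ∈ S.outputAnnihilator i := by
  refine hS.vecMul_aeval_eq_zero i fun j => ?_
  obtain ⟨Q, hQ⟩ := Finset.dvd_prod_of_mem (fun j => (S.transferMatrix i j).denom)
    (Finset.mem_univ j)
  refine ⟨Q * (S.transferMatrix i j).num, ?_⟩
  rw [hQ, map_mul, map_mul]
  have h0 : algebraMap ℝ[X] (RatFunc ℝ) (S.transferMatrix i j).denom ≠ 0 :=
    (map_ne_zero_iff _ (RatFunc.algebraMap_injective ℝ)).mpr (RatFunc.denom_ne_zero _)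
  have h1 := RatFunc.num_div_denom (S.transferMatrix i j)
  rw [div_eq_iff h0] at h1
  rw [h1]
  ring

end StateSpace

/-! ### Trajectories -/

namespace StateSpace

variable {m p n : ℕ}

theorem state_eq_zero (S : StateSpace m p n) {L : ℕ} {x : Fin (L + 1) → Fin n → ℝ}
    (hx : ∀ t : Fin L, x t.succ = S.A.mulVec (x t.castSucc)) (h0 : x 0 = 0) (t : Fin (L + 1)) :
    x t = 0 := by
  induction t using Fin.induction with
  | zero => exact h0
  | succ t ih => rw [hx, ih, Matrix.mulVec_zero]

/-- Trajectories on a finite window extend to the infinite time axis. -/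
theorem exists_extension (S : StateSpace m p n) {L : ℕ}
    {w : (Fin L → Fin m → ℝ) × (Fin L → Fin p → ℝ)} (hw : w ∈ S.trajectories L) :
    ∃ (x : ℕ → Fin n → ℝ) (u : ℕ → Fin m → ℝ),
      (∀ t, x (t + 1) = S.A.mulVec (x t) + S.B.mulVec (u t)) ∧
      ∀ t : Fin L, w.1 t = u t ∧ w.2 t = S.C.mulVec (x t) + S.D.mulVec (u t) := by
  obtain ⟨x, hx⟩ := hw
  let u' : ℕ → Fin m → ℝ := fun t => if h : t < L then w.1 ⟨t, h⟩ else 0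
  let x' : ℕ → Fin n → ℝ := fun t =>
    Nat.rec (x 0) (fun t v => S.A.mulVec v + S.B.mulVec (u' t)) t
  have hu : ∀ t : Fin L, u' t = w.1 t := fun t => by simp [u']
  have hxx : ∀ t : Fin (L + 1), x' t = x t := by
    intro t
    induction t using Fin.induction with
    | zero => rfl
    | succ t ih =>
      rw [(hx t).1, ← ih, ← hu t]
      rfl
  refine ⟨x', u', fun t => rfl, fun t => ⟨(hu t).symm, ?_⟩⟩
  rw [(hx t).2, hu t, ← hxx]
  rfl

/-- Windows of infinite trajectories are trajectories. -/
theorem IsTrajectory.window_mem {S : StateSpace m p n} {u : ℕ → Fin m → ℝ} {y : ℕ → Fin p → ℝ}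
    (h : S.IsTrajectory u y) (t L : ℕ) :
    ((fun k : Fin L => u (t + k)), (fun k : Fin L => y (t + k))) ∈ S.trajectories L := by
  obtain ⟨x, hx⟩ := h
  exact ⟨fun k => x (t + k), fun k => hx (t + k)⟩

/-- Under the rank condition every trajectory is a linear combination of the data. -/
theorem exists_combination_of_rank (S : StateSpace m p n) {N T : ℕ}
    {ud : Fin T → Fin (N + 1) → Fin m → ℝ} {yd : Fin T → Fin (N + 1) → Fin p → ℝ}
    (hdata : ∀ j, (ud j, yd j) ∈ S.trajectories (N + 1))
    (hrank : (dataMatrix ud yd).rank = m * (N + 1) + n)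
    {w : (Fin (N + 1) → Fin m → ℝ) × (Fin (N + 1) → Fin p → ℝ)}
    (hw : w ∈ S.trajectories (N + 1)) :
    ∃ α : Fin T → ℝ, (∀ k, w.1 k = ∑ j, α j • ud j k) ∧ ∀ k, w.2 k = ∑ j, α j • yd j k := by
  choose X hX using hdata
  have hcomb : ∀ (α : Fin T → ℝ) (x : Fin (N + 2) → Fin n → ℝ) (u : Fin (N + 1) → Fin m → ℝ)
      (y : Fin (N + 1) → Fin p → ℝ),
      (∀ t : Fin (N + 1), x t.succ = S.A.mulVec (x t.castSucc) + S.B.mulVec (u t) ∧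
        y t = S.C.mulVec (x t.castSucc) + S.D.mulVec (u t)) →
      (∀ k, u k = ∑ j, α j • ud j k) → x 0 = ∑ j, α j • X j 0 →
      ∀ k, y k = ∑ j, α j • yd j k := by
    intro α x u y hx hu h0 k
    have hz : ∀ t, x t - ∑ j, α j • X j t = 0 := by
      refine S.state_eq_zero (x := fun t => x t - ∑ j, α j • X j t) (fun t => ?_)
        (sub_eq_zero.mpr h0)
      simp only [(hx t).1, hu, (fun j => (hX j t).1), Matrix.mulVec_sub, Matrix.mulVec_sum,
        Matrix.mulVec_smul, smul_add, Finset.sum_add_distrib]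
      abel
    have hyd : ∀ j, yd j k = S.C.mulVec (X j k.castSucc) + S.D.mulVec (ud j k) :=
      fun j => (hX j k).2
    rw [(hx k).2, sub_eq_zero.mp (hz k.castSucc), hu]
    simp only [hyd, Matrix.mulVec_sum, Matrix.mulVec_smul, smul_add,
      Finset.sum_add_distrib]
  -- Each data column depends linearly on its inputs and initial state, which `Z` collects in `m *
  -- (N + 1) + n` rows. So `ker Z` lies in the kernel of the data matrix, and the rank condition
  -- makes `Z` surjective.
  let Z : Matrix ((Fin (N + 1) × Fin m) ⊕ Fin n) (Fin T) ℝ :=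
    Matrix.of fun r j => Sum.elim (fun w => ud j w.1 w.2) (fun s => X j 0 s) r
  have hker : LinearMap.ker Z.mulVecLin ≤ LinearMap.ker (dataMatrix ud yd).mulVecLin := by
    intro α hα
    rw [LinearMap.mem_ker, Matrix.mulVecLin_apply] at hα ⊢
    have hu : ∀ k, (0 : Fin m → ℝ) = ∑ j, α j • ud j k := by
      intro k
      funext a
      have := congrFun hα (Sum.inl (k, a))
      simp only [Matrix.mulVec, dotProduct, Z, Matrix.of_apply, Sum.elim_inl] at this
      simpa [mul_comm] using this.symm
    have h0 : (0 : Fin n → ℝ) = ∑ j, α j • X j 0 := by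
      funext s
      have := congrFun hα (Sum.inr s)
      simp only [Matrix.mulVec, dotProduct, Z, Matrix.of_apply, Sum.elim_inr] at this
      simpa [mul_comm] using this.symm
    have hy := hcomb α 0 0 0 (fun t => by simp) hu h0
    funext r
    rcases r with ⟨k, a⟩ | a | ⟨k, i⟩
    · have := congrFun (hu k.castSucc) a
      simpa [dataMatrix, pastInput, Matrix.mulVec, dotProduct, mul_comm] using this.symm
    · have := congrFun (hu (Fin.last N)) a
      simpa [dataMatrix, futureInput, Matrix.mulVec, dotProduct, mul_comm] using this.symm
    · have := congrFun (hy k.castSucc) i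
      simpa [dataMatrix, pastOutput, Matrix.mulVec, dotProduct, mul_comm] using this.symm
  have htop : LinearMap.range Z.mulVecLin = ⊤ := by
    apply Submodule.eq_top_of_finrank_eq
    have h1 := LinearMap.finrank_range_add_finrank_ker Z.mulVecLin
    have h2 := LinearMap.finrank_range_add_finrank_ker (dataMatrix ud yd).mulVecLin
    have h3 := Submodule.finrank_mono hker
    have h4 := Submodule.finrank_le (LinearMap.range Z.mulVecLin)
    rw [Matrix.rank] at hrank
    have h5 : Module.finrank ℝ ((Fin (N + 1) × Fin m) ⊕ Fin n → ℝ) = m * (N + 1) + n := by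
      simp [mul_comm]
    omega
  obtain ⟨x, hx⟩ := hw
  obtain ⟨α, hα⟩ : ∃ α, Z.mulVecLin α = Sum.elim (fun r => w.1 r.1 r.2) (x 0) :=
    LinearMap.range_eq_top.mp htop _
  rw [Matrix.mulVecLin_apply] at hα
  have hu : ∀ k, w.1 k = ∑ j, α j • ud j k := by
    intro k
    funext a
    have := congrFun hα (Sum.inl (k, a))
    simp only [Matrix.mulVec, dotProduct, Z, Matrix.of_apply, Sum.elim_inl] at this
    simpa [mul_comm] using this.symm
  refine ⟨α, hu, hcomb α x w.1 w.2 hx hu ?_⟩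
  funext s
  have := congrFun hα (Sum.inr s)
  simp only [Matrix.mulVec, dotProduct, Z, Matrix.of_apply, Sum.elim_inr] at this
  simpa [mul_comm] using this.symm

/-! ### Difference equations satisfied by one output -/

/-- The pair `(P, Q)` is a difference equation `P(σ) y_i + ∑ Q_a(σ) u_a = 0` satisfied by all
trajectories. -/
def IsOutputRelation (S : StateSpace m p n) (i : Fin p) (P : ℝ[X]) (Q : Fin m → ℝ[X]) : Prop :=
  ∀ (x : ℕ → Fin n → ℝ) (u : ℕ → Fin m → ℝ),
    (∀ t, x (t + 1) = S.A.mulVec (x t) + S.B.mulVec (u t)) →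
    aeval (seqShift ℝ) P (fun t => (S.C.mulVec (x t) + S.D.mulVec (u t)) i) +
      ∑ a, aeval (seqShift ℝ) (Q a) (fun t => u t a) = 0

namespace IsOutputRelation

variable {S : StateSpace m p n} {i : Fin p} {P P' : ℝ[X]} {Q Q' : Fin m → ℝ[X]}

theorem mul_left (h : S.IsOutputRelation i P Q) (R : ℝ[X]) :
    S.IsOutputRelation i (R * P) (fun a => R * Q a) := by
  intro x u hx
  simp only [map_mul, Module.End.mul_apply, ← map_sum, ← map_add, h x u hx, map_zero]

theorem sub (h : S.IsOutputRelation i P Q) (h' : S.IsOutputRelation i P' Q') :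
    S.IsOutputRelation i (P - P') (fun a => Q a - Q' a) := by
  intro x u hx
  simp only [map_sub, LinearMap.sub_apply, Finset.sum_sub_distrib]
  rw [sub_add_sub_comm, h x u hx, h' x u hx, sub_zero]

/-- Relations can be checked at time zero. -/
theorem of_apply_zero (h : ∀ (x : ℕ → Fin n → ℝ) (u : ℕ → Fin m → ℝ),
    (∀ t, x (t + 1) = S.A.mulVec (x t) + S.B.mulVec (u t)) →
    aeval (seqShift ℝ) P (fun t => (S.C.mulVec (x t) + S.D.mulVec (u t)) i) 0 +
      ∑ a, aeval (seqShift ℝ) (Q a) (fun t => u t a) 0 = 0) :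
    S.IsOutputRelation i P Q := by
  intro x u hx
  funext t
  have := h (fun k => x (t + k)) (fun k => u (t + k)) (fun k => hx (t + k))
  simp only [aeval_seqShift_apply le_rfl, Pi.add_apply, Finset.sum_apply, Pi.zero_apply,
    zero_add] at this ⊢
  exact this

/-- The input is free: a relation among the inputs alone is trivial. -/
theorem eq_zero_of_zero (h : S.IsOutputRelation i 0 Q) (a : Fin m) : Q a = 0 := by
  ext k
  -- An impulse on channel `a` at time `k` reads off the `k`-th coefficient of `Q a` at time zero.
  let u : ℕ → Fin m → ℝ := fun t => if t = k then Pi.single a 1 else 0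
  let x : ℕ → Fin n → ℝ := fun t =>
    Nat.rec 0 (fun t v => S.A.mulVec v + S.B.mulVec (u t)) t
  have h1 := congrFun (h x u fun t => rfl) 0
  have h2 : ∀ b, aeval (seqShift ℝ) (Q b) (fun t => u t b) 0 = if b = a then (Q b).coeff k else 0 := by
    intro b
    rw [aeval_seqShift_apply (le_max_left _ k), ← Finset.sum_range
      (fun l => (Q b).coeff l * u (0 + l) b), Finset.sum_eq_single k]
    · by_cases hb : b = a
      · subst hb; simp [u]
      · simp [u, hb]
    · intro l _ hl
      simp [u, hl]
    · intro hk
      exact absurd (Finset.mem_range.mpr (Nat.lt_succ_of_le (le_max_right _ _))) hk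
  simpa [h2] using h1

/-- With zero input the relation at time zero reads `C_i P(A) x₀ = 0`, and `x₀` is arbitrary. -/
theorem mem_outputAnnihilator (h : S.IsOutputRelation i P Q) : P ∈ S.outputAnnihilator i := by
  obtain ⟨R, -, hR⟩ := exists_state_elimination S.A S.B _ P le_rfl (S.C i)
  rw [StateSpace.mem_outputAnnihilator, ← dotProduct_eq_zero_iff]
  intro x₀
  let x : ℕ → Fin n → ℝ := fun t => Nat.rec x₀ (fun t v => S.A.mulVec v) t
  have hx : ∀ t, x (t + 1) = S.A.mulVec (x t) := fun t => rfl
  have h1 := congrFun (h x 0 fun t => by simp [hx]) 0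
  have h2 := congrFun (hR (ℕ → ℝ) (seqShift ℝ) (fun s t => x t s) 0 (fun s => by
    funext t
    rw [seqShift_apply, hx]
    simp [Matrix.mulVec, dotProduct])) 0
  have h3 : (fun t => (S.C.mulVec (x t) + S.D.mulVec ((0 : ℕ → Fin m → ℝ) t)) i) =
      ∑ s, S.C i s • (fun t => x t s) := by
    funext t
    simp [Matrix.mulVec, dotProduct]
  rw [h3, Pi.add_apply, h2] at h1
  have h4 : ∀ R : ℝ[X], aeval (seqShift ℝ) R (fun _ => 0) 0 = 0 := fun R =>
    congrFun (map_zero (aeval (seqShift ℝ) R)) 0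
  simpa [dotProduct, x, Pi.zero_def, h4] using h1

end IsOutputRelation

theorem exists_isOutputRelation (S : StateSpace m p n) (i : Fin p) {P : ℝ[X]}
    (hP : P ∈ S.outputAnnihilator i) :
    ∃ Q : Fin m → ℝ[X], (∀ a, (Q a).natDegree ≤ P.natDegree) ∧ S.IsOutputRelation i P Q := by
  obtain ⟨R, hRdeg, hR⟩ := exists_state_elimination S.A S.B _ P le_rfl (S.C i)
  refine ⟨fun a => -(R a + P * Polynomial.C (S.D i a)), fun a => ?_, fun x u hx => ?_⟩
  · rw [natDegree_neg]
    refine (natDegree_add_le _ _).trans (max_le ?_ (natDegree_mul_C_le _ _))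
    exact natDegree_le_of_degree_le (hRdeg a).le
  · have h2 := hR (ℕ → ℝ) (seqShift ℝ) (fun s t => x t s) (fun a t => u t a) (fun s => by
      funext t
      rw [seqShift_apply, hx]
      simp [Matrix.mulVec, dotProduct])
    have h3 : (fun t => (S.C.mulVec (x t) + S.D.mulVec (u t)) i) =
        ∑ s, S.C i s • (fun t => x t s) + ∑ a, S.D i a • (fun t => u t a) := by
      funext t
      simp [Matrix.mulVec, dotProduct]
    rw [h3, map_add, h2, StateSpace.mem_outputAnnihilator.mp hP]
    simp [Module.algebraMap_end_apply, Finset.sum_add_distrib]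

end StateSpace

/-! ### Least-squares solutions -/

section MoorePenroseSolution

variable {ι κ : Type*} [Fintype ι] [Fintype κ]

theorem vecMul_moorePenrose_vecMul {H : Matrix ι κ ℝ} {b : κ → ℝ} {c : ι → ℝ}
    (hc : Matrix.vecMul c H = b) : Matrix.vecMul (Matrix.vecMul b (moorePenrose H)) H = b := by
  rw [← hc, Matrix.vecMul_vecMul, Matrix.vecMul_vecMul, ← Matrix.mul_assoc,
    (isMoorePenrose_moorePenrose H).1]

/-- The row `b H†` is fixed by `H H†`, which is symmetric and kills the left kernel of `H`. This is
the minimum-norm property of the pseudoinverse. -/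
theorem vecMul_moorePenrose_dotProduct_eq_zero {H : Matrix ι κ ℝ} (b : κ → ℝ) {v : ι → ℝ}
    (hv : Matrix.vecMul v H = 0) : Matrix.vecMul b (moorePenrose H) ⬝ᵥ v = 0 := by
  obtain ⟨-, h2, h3, -⟩ := isMoorePenrose_moorePenrose H
  calc _ = Matrix.vecMul (Matrix.vecMul b (moorePenrose H)) (H * moorePenrose H) ⬝ᵥ v := by
        rw [Matrix.vecMul_vecMul, ← Matrix.mul_assoc, h2]
    _ = 0 := by
        rw [← Matrix.dotProduct_mulVec, ← h3, Matrix.mulVec_transpose, ← Matrix.vecMul_vecMul, hv,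
          Matrix.zero_vecMul, dotProduct_zero]

end MoorePenroseSolution

/-! ### The difference equation of the predictor -/

section Predictor

variable {m p n N T : ℕ}

/-- The regressor `col(u(0:N-1), u(N), v(0:N-1))`. -/
def regressor (u : Fin (N + 1) → Fin m → ℝ) (v : Fin N → ℝ) :
    (Fin N × Fin m) ⊕ (Fin m ⊕ Fin N) → ℝ :=
  Sum.elim (fun r => u r.1.castSucc r.2) (Sum.elim (u (Fin.last N)) v)

/-- The coefficients of a pair `(P, Q)` that multiply the entries of a regressor. -/
def relationCoeffs (N : ℕ) (P : ℝ[X]) (Q : Fin m → ℝ[X]) :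
    (Fin N × Fin m) ⊕ (Fin m ⊕ Fin N) → ℝ :=
  Sum.elim (fun r => (Q r.2).coeff r.1) (Sum.elim (fun a => (Q a).coeff N) (fun k => P.coeff k))

theorem relationCoeffs_dotProduct_regressor (P : ℝ[X]) (Q : Fin m → ℝ[X])
    (u : Fin (N + 1) → Fin m → ℝ) (v : Fin N → ℝ) :
    relationCoeffs N P Q ⬝ᵥ regressor u v =
      ∑ k : Fin N, P.coeff k * v k + ∑ a, ∑ k : Fin (N + 1), (Q a).coeff k * u k a := by
  simp only [dotProduct, relationCoeffs, regressor, Fintype.sum_sum_type, Sum.elim_inl,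
    Sum.elim_inr, Fintype.sum_prod_type, Fin.sum_univ_castSucc, Finset.sum_add_distrib,
    Fin.val_castSucc, Fin.val_last]
  rw [Finset.sum_comm (s := (Finset.univ : Finset (Fin N)))]
  ring

theorem relationCoeffs_dotProduct_self (P P' : ℝ[X]) (Q Q' : Fin m → ℝ[X]) :
    relationCoeffs N P Q ⬝ᵥ relationCoeffs N P' Q' =
      ∑ k : Fin N, P.coeff k * P'.coeff k +
        ∑ a, ∑ k : Fin (N + 1), (Q a).coeff k * (Q' a).coeff k :=
  relationCoeffs_dotProduct_regressor P Q (fun k a => (Q' a).coeff k) (fun k => P'.coeff k)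

theorem vecMul_outputDataMatrix (ud : Fin T → Fin (N + 1) → Fin m → ℝ)
    (yd : Fin T → Fin (N + 1) → Fin p → ℝ) (i : Fin p)
    (c : (Fin N × Fin m) ⊕ (Fin m ⊕ Fin N) → ℝ) (j : Fin T) :
    Matrix.vecMul c (outputDataMatrix ud yd i) j =
      c ⬝ᵥ regressor (ud j) (fun k => yd j k.castSucc i) := by
  rw [Matrix.vecMul]
  congr 1
  funext r
  rcases r with r | a | k <;> rfl

variable {S : StateSpace m p n} {i : Fin p}

/-- The regressor lacks `y_i(N)`, so the degree `N` term of `P` moves to the right. A monic `P` of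
degree `N` thus gives an exact predictor, and `P` of lower degree a vector in the left kernel of
`H_i`. -/
theorem StateSpace.IsOutputRelation.dotProduct_regressor {P : ℝ[X]} {Q : Fin m → ℝ[X]}
    (h : S.IsOutputRelation i P Q) (hP : P.natDegree ≤ N) (hQ : ∀ a, (Q a).natDegree ≤ N)
    {w : (Fin (N + 1) → Fin m → ℝ) × (Fin (N + 1) → Fin p → ℝ)}
    (hw : w ∈ S.trajectories (N + 1)) :
    relationCoeffs N P Q ⬝ᵥ regressor w.1 (fun k => w.2 k.castSucc i) =
      -(P.coeff N * w.2 (Fin.last N) i) := by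
  obtain ⟨x, u, hx, hxu⟩ := S.exists_extension hw
  have h0 : aeval (seqShift ℝ) P (fun t => (S.C.mulVec (x t) + S.D.mulVec (u t)) i) 0 +
      (∑ a, aeval (seqShift ℝ) (Q a) (fun t => u t a)) 0 = 0 := congrFun (h x u hx) 0
  simp only [Finset.sum_apply, aeval_seqShift_apply hP,
    aeval_seqShift_apply (hQ _), zero_add, ← (hxu _).2] at h0
  simp only [← (hxu _).1] at h0
  rw [Fin.sum_univ_castSucc] at h0
  rw [relationCoeffs_dotProduct_regressor]
  simp only [Fin.val_castSucc, Fin.val_last] at h0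
  linarith

/-- The output polynomial `z ^ N - ∑ k, c_k z ^ k` of a predictor with coefficients `c`. -/
noncomputable def predictorPolynomial (c : (Fin N × Fin m) ⊕ (Fin m ⊕ Fin N) → ℝ) : ℝ[X] :=
  X ^ N - ∑ k : Fin N, C (c (Sum.inr (Sum.inr k))) * X ^ (k : ℕ)

/-- The input polynomials of a predictor with coefficients `c`. -/
noncomputable def predictorInputPolynomial (c : (Fin N × Fin m) ⊕ (Fin m ⊕ Fin N) → ℝ)
    (a : Fin m) : ℝ[X] :=
  -(∑ k : Fin N, C (c (Sum.inl (k, a))) * X ^ (k : ℕ) + C (c (Sum.inr (Sum.inl a))) * X ^ N)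

theorem coeff_sum_fin (g : Fin N → ℝ) (l : ℕ) :
    (∑ k : Fin N, C (g k) * X ^ (k : ℕ)).coeff l = if h : l < N then g ⟨l, h⟩ else 0 := by
  simp only [finsetSum_coeff, coeff_C_mul, coeff_X_pow]
  split_ifs with h
  · rw [Finset.sum_eq_single ⟨l, h⟩]
    · simp
    · intro k _ hk
      rw [if_neg (fun hl => hk (Fin.ext hl.symm)), mul_zero]
    · simp
  · refine Finset.sum_eq_zero fun k _ => ?_
    rw [if_neg (by have := k.2; omega), mul_zero]

theorem predictorPolynomial_monic (c : (Fin N × Fin m) ⊕ (Fin m ⊕ Fin N) → ℝ) :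
    (predictorPolynomial c).Monic :=
  (monic_X_pow N).sub_of_left (by rw [degree_X_pow]; exact degree_sum_fin_lt _)

theorem natDegree_predictorPolynomial (c : (Fin N × Fin m) ⊕ (Fin m ⊕ Fin N) → ℝ) :
    (predictorPolynomial c).natDegree = N := by
  refine natDegree_eq_of_degree_eq_some ?_
  rw [predictorPolynomial, degree_sub_eq_left_of_degree_lt, degree_X_pow]
  rw [degree_X_pow]
  exact degree_sum_fin_lt _

theorem coeff_predictorPolynomial (c : (Fin N × Fin m) ⊕ (Fin m ⊕ Fin N) → ℝ) :
    (predictorPolynomial c).coeff N = 1 := by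
  rw [predictorPolynomial, coeff_sub, coeff_sum_fin, coeff_X_pow_self, dif_neg (lt_irrefl N),
    sub_zero]

theorem natDegree_predictorInputPolynomial_le (c : (Fin N × Fin m) ⊕ (Fin m ⊕ Fin N) → ℝ)
    (a : Fin m) : (predictorInputPolynomial c a).natDegree ≤ N := by
  rw [predictorInputPolynomial, natDegree_neg]
  exact (natDegree_add_le _ _).trans (max_le
    (natDegree_le_of_degree_le (degree_sum_fin_lt _).le) (natDegree_C_mul_X_pow_le _ _))

/-- The vector `v` is arbitrary, not only a regressor: in the orthogonality argument it is itself a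
coefficient vector. -/
theorem predictor_dotProduct (c v : (Fin N × Fin m) ⊕ (Fin m ⊕ Fin N) → ℝ) :
    c ⬝ᵥ v = -(relationCoeffs N (predictorPolynomial c) (predictorInputPolynomial c) ⬝ᵥ v) := by
  rw [← neg_dotProduct]
  congr 1
  funext r
  rcases r with ⟨k, a⟩ | a | k <;>
    simp only [Pi.neg_apply, relationCoeffs, predictorInputPolynomial, predictorPolynomial,
      Sum.elim_inl, Sum.elim_inr, coeff_neg, coeff_add, coeff_sub, coeff_sum_fin, coeff_C_mul,
      coeff_X_pow]
  · simp [k.2.ne]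
  · simp
  · simp [k.2.ne]

theorem isOutputRelation_predictor {c : (Fin N × Fin m) ⊕ (Fin m ⊕ Fin N) → ℝ}
    (hc : ∀ w ∈ S.trajectories (N + 1),
      c ⬝ᵥ regressor w.1 (fun k => w.2 k.castSucc i) = w.2 (Fin.last N) i) :
    S.IsOutputRelation i (predictorPolynomial c) (predictorInputPolynomial c) := by
  refine StateSpace.IsOutputRelation.of_apply_zero fun x u hx => ?_
  have h := hc ((fun k => u k), (fun k => S.C.mulVec (x k) + S.D.mulVec (u k)))
    ⟨fun k => x k, fun k => ⟨hx k, rfl⟩⟩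
  rw [predictor_dotProduct, relationCoeffs_dotProduct_regressor] at h
  simp only [aeval_seqShift_apply (natDegree_predictorPolynomial c).le,
    aeval_seqShift_apply (natDegree_predictorInputPolynomial_le c _), zero_add]
  rw [Fin.sum_univ_castSucc]
  simp only [Fin.val_castSucc, Fin.val_last, coeff_predictorPolynomial, one_mul] at h ⊢
  linarith

variable {ud : Fin T → Fin (N + 1) → Fin m → ℝ} {yd : Fin T → Fin (N + 1) → Fin p → ℝ}

/-- The predictor row reproduces the last output sample of every trajectory. -/
theorem predictorRow_dotProduct_regressor (hmin : S.IsMinimal)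
    (hrow : minimalOrder (outputRow S.transferMatrix i) ≤ N)
    (hdata : ∀ j, (ud j, yd j) ∈ S.trajectories (N + 1))
    (hrank : (dataMatrix ud yd).rank = m * (N + 1) + n)
    {w : (Fin (N + 1) → Fin m → ℝ) × (Fin (N + 1) → Fin p → ℝ)}
    (hw : w ∈ S.trajectories (N + 1)) :
    predictorRow ud yd i ⬝ᵥ regressor w.1 (fun k => w.2 k.castSucc i) = w.2 (Fin.last N) i := by
  obtain ⟨P₀, hP₀, hdeg, hann⟩ := hmin.exists_monic_vecMul_aeval_eq_zero i
  -- A shift raises the degree to exactly `N`; this is possible because the order of the row is at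
  -- most `N`.
  set P := X ^ (N - P₀.natDegree) * P₀ with hP
  have hPdeg : P.natDegree = N := by
    rw [hP, (monic_X_pow _).natDegree_mul hP₀, natDegree_X_pow]
    omega
  have hPm : P.coeff N = 1 := by
    have : P.Monic := (monic_X_pow _).mul hP₀
    rw [Monic, leadingCoeff, hPdeg] at this
    exact this
  obtain ⟨Q, hQ, hrel⟩ := S.exists_isOutputRelation i
    (Ideal.mul_mem_left _ (X ^ (N - P₀.natDegree)) (StateSpace.mem_outputAnnihilator.mpr hann))
  have hsol : Matrix.vecMul (-relationCoeffs N P Q) (outputDataMatrix ud yd i) =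
      futureOutput yd i := by
    funext j
    rw [vecMul_outputDataMatrix, neg_dotProduct,
      hrel.dotProduct_regressor hPdeg.le (fun a => hPdeg ▸ hQ a) (hdata j), hPm, one_mul, neg_neg]
    rfl
  have hK := vecMul_moorePenrose_vecMul hsol
  obtain ⟨α, h1, h2⟩ := S.exists_combination_of_rank hdata hrank hw
  have hreg : regressor w.1 (fun k => w.2 k.castSucc i) =
      ∑ j, α j • regressor (ud j) (fun k => yd j k.castSucc i) := by
    funext r
    rcases r with ⟨k, a⟩ | a | k
    · simp [regressor, h1]
    · simp [regressor, h1]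
    · simp [regressor, h2]
  rw [hreg, dotProduct_sum, h2, Finset.sum_apply]
  refine Finset.sum_congr rfl fun j _ => ?_
  rw [dotProduct_smul, ← vecMul_outputDataMatrix, predictorRow, hK]
  rfl

/-- The predictor of an output is stable iff the corresponding row of the transfer matrix is. -/
theorem predictorPolynomial_stable_iff (hmin : S.IsMinimal)
    (hrow : minimalOrder (outputRow S.transferMatrix i) ≤ N)
    (hdata : ∀ j, (ud j, yd j) ∈ S.trajectories (N + 1))
    (hrank : (dataMatrix ud yd).rank = m * (N + 1) + n) :
    (∀ z : ℂ, aeval z (predictorPolynomial (predictorRow ud yd i)) = 0 → ‖z‖ < 1) ↔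
      ∀ j, ∀ z : ℂ, aeval z (S.transferMatrix i j).denom = 0 → ‖z‖ < 1 := by
  set K := predictorRow ud yd i with hK
  have hrel : S.IsOutputRelation i (predictorPolynomial K) (predictorInputPolynomial K) :=
    isOutputRelation_predictor fun w hw =>
      predictorRow_dotProduct_regressor hmin hrow hdata hrank hw
  have hmem := hrel.mem_outputAnnihilator
  have hmonic := predictorPolynomial_monic K
  constructor
  · intro h j z hz
    obtain ⟨R, hR⟩ := StateSpace.denom_dvd_of_mem_outputAnnihilator hmem hmonic.ne_zero j
    exact h z (by rw [hR, map_mul, hz, zero_mul])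
  · intro h z hz
    set f := Submodule.IsPrincipal.generator (S.outputAnnihilator i) with hf
    have hfmem : f ∈ S.outputAnnihilator i := Submodule.IsPrincipal.generator_mem _
    obtain ⟨r, hr⟩ := (Submodule.IsPrincipal.mem_iff_generator_dvd _).mp hmem
    rw [← hf] at hr
    have hf0 : f ≠ 0 := by
      rintro h0
      exact hmonic.ne_zero (by rw [hr, h0, zero_mul])
    have hr0 : r ≠ 0 := by
      rintro rfl
      exact hmonic.ne_zero (by rw [hr, mul_zero])
    obtain ⟨q, hqdeg, hq⟩ := S.exists_isOutputRelation i hfmem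
    -- Subtracting `r` times the relation `(f, q)` leaves a relation among inputs only, which is
    -- trivial. Hence `r` divides the input part as well.
    have hQ : ∀ a, predictorInputPolynomial K a = r * q a := by
      intro a
      have h1 := hrel.sub (hq.mul_left r)
      rw [hr, mul_comm f, sub_self] at h1
      exact sub_eq_zero.mp (h1.eq_zero_of_zero a)
    have hdeg : r.natDegree + f.natDegree = N := by
      rw [← natDegree_predictorPolynomial K, hr, natDegree_mul hf0 hr0, add_comm]
    rw [hr, map_mul, mul_eq_zero] at hz
    rcases hz with hz | hz
    · obtain ⟨R, hR⟩ := (Submodule.IsPrincipal.mem_iff_generator_dvd _).mp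
        (hmin.prod_denom_mem_outputAnnihilator i)
      have h1 : aeval z (∏ j, (S.transferMatrix i j).denom) = 0 := by
        rw [hR, map_mul, ← hf, hz, zero_mul]
      rw [map_prod, Finset.prod_eq_zero_iff] at h1
      obtain ⟨j, -, hj⟩ := h1
      exact h j z hj
    -- The index `none` stands for the output polynomial `f`, and `some a` for the input polynomial
    -- `q a`.
    · refine norm_root_lt_one_of_orthogonal (f := fun o : Option (Fin m) => o.elim f q)
        (d := f.natDegree) ?_ (i₀ := none) hf0 hr0 rfl hdeg ?_ hz
      · rintro (_ | a)
        · exact le_rfl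
        · exact hqdeg a
      · intro j hj
        have hdf : (X ^ j * f).natDegree < N := by
          rw [natDegree_X_pow_mul _ hf0]
          omega
        have hdq : ∀ a, (X ^ j * q a).natDegree ≤ N := by
          intro a
          refine natDegree_mul_le.trans ?_
          rw [natDegree_X_pow]
          have := hqdeg a
          omega
        -- For `j < deg r` the output part has degree below `N`, so the shifted relation does not
        -- involve `y_i(N)` and annihilates `H_i`.
        have h0 : Matrix.vecMul (relationCoeffs N (X ^ j * f) (fun a => X ^ j * q a))
            (outputDataMatrix ud yd i) = 0 := by
          funext l
          rw [vecMul_outputDataMatrix,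
            (hq.mul_left (X ^ j)).dotProduct_regressor hdf.le hdq (hdata l),
            coeff_eq_zero_of_natDegree_lt hdf]
          simp
        have h1 := vecMul_moorePenrose_dotProduct_eq_zero (futureOutput yd i) h0
        have h2 : K ⬝ᵥ relationCoeffs N (X ^ j * f) (fun a => X ^ j * q a) = 0 := h1
        rw [predictor_dotProduct, neg_eq_zero,
          relationCoeffs_dotProduct_self] at h2
        rw [Fintype.sum_option, Fin.sum_univ_castSucc]
        simp only [Option.elim_none, Option.elim_some, Fin.val_castSucc, Fin.val_last,
          coeff_eq_zero_of_natDegree_lt hdf, mul_zero, add_zero]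
        simp only [hQ, hr, mul_comm f r] at h2
        exact h2

theorem predictedOutput_of_lt (u : ℕ → Fin m → ℝ) (y0 : Fin N → Fin p → ℝ) {s : ℕ} (h : s < N) :
    predictedOutput ud yd u y0 s = y0 ⟨s, h⟩ := by
  rw [predictedOutput, dif_pos h]

theorem predictedOutput_add (u : ℕ → Fin m → ℝ) (y0 : Fin N → Fin p → ℝ) (t : ℕ) (i : Fin p) :
    predictedOutput ud yd u y0 (t + N) i = predictorRow ud yd i ⬝ᵥ
      regressor (fun k => u (t + k)) (fun k => predictedOutput ud yd u y0 (t + k) i) := by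
  rw [predictedOutput, dif_neg (by omega)]
  simp only [Nat.add_sub_cancel]
  rfl

/-- The prediction error of each output obeys the recurrence of the predictor polynomial. -/
theorem aeval_predictorPolynomial_error (hmin : S.IsMinimal)
    (hrow : minimalOrder (outputRow S.transferMatrix i) ≤ N)
    (hdata : ∀ j, (ud j, yd j) ∈ S.trajectories (N + 1))
    (hrank : (dataMatrix ud yd).rank = m * (N + 1) + n)
    {u : ℕ → Fin m → ℝ} {y : ℕ → Fin p → ℝ}
    (hwin : ∀ t, ((fun k : Fin (N + 1) => u (t + k)), (fun k : Fin (N + 1) => y (t + k))) ∈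
      S.trajectories (N + 1)) (y0 : Fin N → Fin p → ℝ) :
    aeval (seqShift ℝ) (predictorPolynomial (predictorRow ud yd i))
      (fun s => y s i - predictedOutput ud yd u y0 s i) = 0 := by
  funext t
  have h1 := predictorRow_dotProduct_regressor hmin hrow hdata hrank (hwin t) (i := i)
  have h2 := predictedOutput_add (ud := ud) (yd := yd) u y0 t i
  simp only [Fin.val_castSucc, Fin.val_last] at h1
  have h3 : ∀ v : ℕ → ℝ, predictorRow ud yd i ⬝ᵥ
      regressor (fun k => u (t + k)) (fun k => v (t + k)) =
      -(∑ k : Fin N, (predictorPolynomial (predictorRow ud yd i)).coeff k * v (t + k) +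
        ∑ a, ∑ k : Fin (N + 1),
          (predictorInputPolynomial (predictorRow ud yd i) a).coeff k * u (t + k) a) := by
    intro v
    rw [predictor_dotProduct, relationCoeffs_dotProduct_regressor]
  rw [h3 (fun s => y s i)] at h1
  rw [h3 (fun s => predictedOutput ud yd u y0 s i)] at h2
  rw [aeval_seqShift_apply (natDegree_predictorPolynomial _).le, Fin.sum_univ_castSucc]
  simp only [Fin.val_castSucc, Fin.val_last, coeff_predictorPolynomial, mul_sub, Finset.sum_sub_distrib, Pi.zero_apply]
  linarith

end Predictor

/-! ### Asymptotic prediction and stability -/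

theorem corollary1 {m p n n' N T : ℕ}
    -- the system, in a state-space representation with `n'` states
    (S : StateSpace m p n')
    -- a minimal realization of the same system, of minimal order `n`
    (S₀ : StateSpace m p n)
    (hG : S₀.transferMatrix = S.transferMatrix)
    (hmin : S₀.IsMinimal)
    (hbeh : ∀ k, S₀.trajectories k = S.trajectories k)
    -- `N` is at least the lag, and at least the minimal order of each output channel
    (hlag : S₀.observabilityIndex ≤ N)
    (hrow : ∀ i, minimalOrder (outputRow S.transferMatrix i) ≤ N)
    -- the data and the rank condition
    (ud : Fin T → Fin (N + 1) → Fin m → ℝ) (yd : Fin T → Fin (N + 1) → Fin p → ℝ)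
    (hdata : ∀ j, (ud j, yd j) ∈ S.trajectories (N + 1))
    (hrank : (dataMatrix ud yd).rank = m * (N + 1) + n)
    -- the trajectory that is to be predicted
    (u : ℕ → Fin m → ℝ) (y : ℕ → Fin p → ℝ) (htraj : S.IsTrajectory u y) :
    (∀ y0 : Fin N → Fin p → ℝ,
      Tendsto (fun s => ‖WithLp.toLp 2 (y s - predictedOutput ud yd u y0 s)‖) atTop (𝓝 0)) ↔
    IsStableTransfer S.transferMatrix := by
  rw [← hG] at hrow ⊢
  rw [← hbeh] at hdata
  -- Only windows of length `N + 1` enter the predictor, so equality of the finite behaviours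
  -- suffices to pass to the minimal realization.
  have hwin : ∀ t, ((fun k : Fin (N + 1) => u (t + k)), (fun k : Fin (N + 1) => y (t + k))) ∈
      S₀.trajectories (N + 1) := fun t => hbeh (N + 1) ▸ htraj.window_mem t (N + 1)
  have hnorm : ∀ y0 : Fin N → Fin p → ℝ,
      Tendsto (fun s => ‖WithLp.toLp 2 (y s - predictedOutput ud yd u y0 s)‖) atTop (𝓝 0) ↔
      ∀ i, Tendsto (fun s => y s i - predictedOutput ud yd u y0 s i) atTop (𝓝 0) := by
    intro y0
    rw [← tendsto_zero_iff_norm_tendsto_zero]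
    constructor
    · intro h i
      have h1 := ((PiLp.continuous_apply 2 (fun _ : Fin p => ℝ) i).tendsto 0).comp h
      exact h1
    · intro h
      have h1 : Tendsto (fun s => y s - predictedOutput ud yd u y0 s) atTop (𝓝 0) :=
        tendsto_pi_nhds.mpr h
      exact ((PiLp.continuous_toLp 2 (fun _ : Fin p => ℝ)).tendsto 0).comp h1
  simp only [hnorm]
  have hstable : IsStableTransfer S₀.transferMatrix ↔ ∀ i, ∀ z : ℂ,
      aeval z (predictorPolynomial (predictorRow ud yd i)) = 0 → ‖z‖ < 1 :=
    forall_congr' fun i => (predictorPolynomial_stable_iff hmin (hrow i) hdata hrank).symm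
  rw [hstable]
  constructor
  · intro h i z hz
    refine norm_root_lt_one_of_recurrence (fun e he => ?_) hz
    -- For the initial guess `y - e` the error starts with the values of `e`; since both solve the
    -- same recurrence of order `N`, the error is `e`.
    have h1 := h (fun k i => y k i - e k) i
    convert h1 using 1
    refine eq_of_aeval_seqShift_eq_zero (predictorPolynomial_monic _)
      (natDegree_predictorPolynomial _) he
      (aeval_predictorPolynomial_error hmin (hrow i) hdata hrank hwin _) fun k hk => ?_
    rw [predictedOutput_of_lt _ _ hk]
    simp
  · intro h y0 i
    exact tendsto_zero_of_recurrence (predictorPolynomial_monic _) (h i)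
      (aeval_predictorPolynomial_error hmin (hrow i) hdata hrank hwin y0)
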